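/- **Setting.** Fix numbers $T,K,p,q,d$. An individual makes $T$ choices among $K$ alternatives, with regressors $X_{tk}\in\mathbb R^p$, $\tilde X_{tk}\in\mathbb R^q$. In the panel multinomial probit (MNP) model with parameter $\theta\in\mathbb R^d$ the utilities are $U_{tk}=X_{tk}'\beta(\theta)+\tilde X_{tk}'\alpha+e_{tk}$, where $\alpha\sim N(0,\Omega(\theta))$ and $e_{t\cdot}\sim N(0,\Sigma(\theta))$, $t=1,\dots,T$, are independent of each other and of the regressors, and at occasion $t$ an alternative of maximal utility is chosen. An observation is $Z=(Y,X,\tilde X)$ with $Y_t$ the choice at occasion $t$. The pairwise composite log-likelihood of one individual is $$lcml(\theta;Z)=\sum_{t<t'}\log \mathbb P_\theta(C_t=Y_t,\,C_{t'}=Y_{t'}\mid X,\tilde X).$$ The Solow--Joe (SJ) approximation of a Gaussian distribution function with correlation matrix $R$ is $$\Phi_D(b;0,R)\approx\Phi_2(b_1,b_2;R_{12})\prod_{j=3}^{D}\Big(\Phi(b_j)+q_j'Q_j^{-1}\,[\,1-\Phi(b_i)\,]_{i<j}\Big),\qquad Q_j=[\mathrm{Cov}(I_i,I_l)]_{i,l<j},\quad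 q_j=[\mathrm{Cov}(I_j,I_i)]_{i<j},$$ where $I_i=\mathbb 1\{u_i\le b_i\}$ and $u\sim N(0,R)$; it is averaged over a fixed finite nonempty family of orderings of the coordinates. It is applied to MNP choice probabilities written as Gaussian distribution functions of the standardised utility differences. The model implied by the SJ approximation has as conditional choice probabilities given the regressors (of the whole sequence of choices or, alternatively, of every pair of choices) the approximated probabilities, normalised to sum to one over all choice patterns. **Assumptions.** Let $\Theta\subset\mathbb R^d$ be compact and $\theta_0$ an interior point of $\Theta$. Let $\beta,\Omega,\Sigma$ be three times continuously differentiable in the interior of $\Theta$ and, for all $\theta\in\Theta$, let $\Omega(\theta)$ be positive semidefinite and $\Sigma(\theta)$ positive definite with $\|\Sigma(\theta)^{-1}\|\le M_\Sigma$. Let the regressors be random with $\|X_{tk}\|\le M_X$ and $\|\tilde X_{tk}\|\le\tilde M_X$ almost surely. **Theorem.** Suppose that $Z$ is generated by the MNP model with parameter $\theta_0$. Then the following regularity conditions hold for $lcml$: 1. there is a neighbourhood of $\theta_0$ on which $\theta\mapsto lcml(\theta;Z)$ is, almost surely, three times continuously differentiable, and on which all derivatives up to order three are dominated by functions of $Z$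 with finite mean under $\theta_0$; 2. the score $\partial_\theta\, lcml(\theta_0;Z)$ has finite fourth moments under $\theta_0$. Suppose instead that $Z$ is generated by the model implied by the SJ approximation with parameter $\theta_0$, and that at $\theta_0$ the approximated probabilities of all choices at all pairs of occasions are positive for all regressors in the support of their law. Then the same conditions 1 and 2 hold for the pairwise composite log-likelihood formed with the SJ-approximated pair probabilities, both unnormalised and normalised to sum to one. -/

import Mathlib

open MeasureTheory ProbabilityTheory
open scoped Topology Matrix

noncomputable section

namespace PanelProbit

/-! ### Data of one decision maker -/

/-- Regressors of one individual: the vectors `X t k` (first component, entering with the fixed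
coefficients) and `X̃ t k` (second component, entering with the random coefficients), for the
choice occasions `t : Fin T` and the alternatives `k : Fin K`. -/
abbrev Regressors (T K p q : ℕ) : Type :=
  (Fin T → Fin K → EuclideanSpace ℝ (Fin p)) × (Fin T → Fin K → EuclideanSpace ℝ (Fin q))

/-- One observation: the sequence of chosen alternatives together with the regressors. -/
abbrev Observation (T K p q : ℕ) : Type := (Fin T → Fin K) × Regressors T K p q

/-- The choices at the occasions in `A`. -/
abbrev choicesOn {T K : ℕ} (A : Finset (Fin T)) (y : Fin T → Fin K) : A → Fin K := fun t => y t

/-! ### The multinomial probit model -/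

/-- A parametrisation, by `θ ∈ ℝ^d`, of the fixed coefficients `β`, of the covariance matrix `Ω` of
the random coefficients and of the covariance matrix `Σ` of the errors. -/
structure Param (K p q d : ℕ) where
  beta : EuclideanSpace ℝ (Fin d) → EuclideanSpace ℝ (Fin p)
  Omega : EuclideanSpace ℝ (Fin d) → Matrix (Fin q) (Fin q) ℝ
  Sigma : EuclideanSpace ℝ (Fin d) → Matrix (Fin K) (Fin K) ℝ

/-- The random utility `U t k = X t k · b + X̃ t k · a + e t k`. -/
def utility {T K p q : ℕ} (b : EuclideanSpace ℝ (Fin p)) (x : Regressors T K p q)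
    (w : EuclideanSpace ℝ (Fin q) × (Fin T → EuclideanSpace ℝ (Fin K)))
    (t : Fin T) (k : Fin K) : ℝ :=
  inner ℝ (x.1 t k) b + inner ℝ (x.2 t k) w.1 + w.2 t k

variable {T K p q d : ℕ}

/-- Joint law of the random coefficients `α ~ N(0, Ω)` and of the errors `e t ~ N(0, Σ)`, which are
independent over `t` and independent of `α`. -/
def noiseLaw (T : ℕ) (m : Param K p q d) (θ : EuclideanSpace ℝ (Fin d)) :
    Measure (EuclideanSpace ℝ (Fin q) × (Fin T → EuclideanSpace ℝ (Fin K))) :=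
  (multivariateGaussian 0 (m.Omega θ)).prod
    (Measure.pi fun _ : Fin T => multivariateGaussian 0 (m.Sigma θ))

/-- Probit probability, given the regressors `x`, that for each occasion `t ∈ A` the alternative
`y t` has maximal utility. -/
def mnpProb (m : Param K p q d) (θ : EuclideanSpace ℝ (Fin d)) (A : Finset (Fin T))
    (y : A → Fin K) (x : Regressors T K p q) : ℝ :=
  (noiseLaw T m θ).real
    {w | ∀ t : A, ∀ k : Fin K, utility (m.beta θ) x w t k ≤ utility (m.beta θ) x w t (y t)}

/-! ### The Solow-Joe approximation -/

/-- The indicator `I_i = 1{u_i ≤ b_i}`. -/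
def ind {D : ℕ} (b : Fin D → ℝ) (i : Fin D) (u : EuclideanSpace ℝ (Fin D)) : ℝ :=
  Set.indicator {v : EuclideanSpace ℝ (Fin D) | v i ≤ b i} (fun _ => 1) u

/-- `Cov(I_i, I_j)` under `N(0, R)`. -/
def indCov {D : ℕ} (b : Fin D → ℝ) (R : Matrix (Fin D) (Fin D) ℝ) (i j : Fin D) : ℝ :=
  covariance (ind b i) (ind b j) (multivariateGaussian 0 R)

/-- The standard normal distribution function. -/
def stdNormalCDF (s : ℝ) : ℝ := cdf (gaussianReal 0 1) s

/-- The linear projection `Φ(b_j) + q' Q⁻¹ [1 - Φ(b_i)]_{i < j}` replacing the conditional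
probability of `I_j = 1` given `I_i = 1` for all `i < j`. -/
def sjFactor {D : ℕ} (b : Fin D → ℝ) (R : Matrix (Fin D) (Fin D) ℝ) (j : Fin D) : ℝ :=
  let Q : Matrix {i : Fin D // i < j} {i : Fin D // i < j} ℝ :=
    Matrix.of fun i l => indCov b R i l
  let r : {i : Fin D // i < j} → ℝ := fun i => indCov b R j i
  stdNormalCDF (b j) + r ⬝ᵥ (Q⁻¹ *ᵥ fun i => 1 - stdNormalCDF (b i))

/-- The Solow-Joe approximation of the Gaussian distribution function `Φ_D(b; 0, R)`, for a
correlation matrix `R`: the exact probability for the first two coordinates, times the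
linear projections for the other ones. -/
def sjCDF {D : ℕ} (b : Fin D → ℝ) (R : Matrix (Fin D) (Fin D) ℝ) : ℝ :=
  (multivariateGaussian 0 R).real {u | ∀ i : Fin D, (i : ℕ) < 2 → u i ≤ b i} *
    ∏ j ∈ Finset.univ.filter (fun j : Fin D => 2 ≤ (j : ℕ)), sjFactor b R j

/-- Index set of the utility differences `U t k - U t (y t)`, `t ∈ A`, `k ≠ y t`. -/
abbrev DiffIdx (A : Finset (Fin T)) (y : A → Fin K) : Type :=
  {i : A × Fin K // i.2 ≠ y i.1}

/-- `- E (U t k - U t (y t))`: the upper limit for the centred utility difference. -/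
def diffLimit (m : Param K p q d) (θ : EuclideanSpace ℝ (Fin d)) (A : Finset (Fin T))
    (y : A → Fin K) (x : Regressors T K p q) (i : DiffIdx A y) : ℝ :=
  inner ℝ (x.1 i.1.1 (y i.1.1) - x.1 i.1.1 i.1.2) (m.beta θ)

/-- Covariance of the utility differences `U t k - U t (y t)` and `U s l - U s (y s)`. -/
def diffCov (m : Param K p q d) (θ : EuclideanSpace ℝ (Fin d)) (A : Finset (Fin T))
    (y : A → Fin K) (x : Regressors T K p q) : Matrix (DiffIdx A y) (DiffIdx A y) ℝ :=
  Matrix.of fun i j =>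
    (x.2 i.1.1 i.1.2 - x.2 i.1.1 (y i.1.1)).ofLp ⬝ᵥ
        (m.Omega θ *ᵥ (x.2 j.1.1 j.1.2 - x.2 j.1.1 (y j.1.1)).ofLp) +
      if i.1.1 = j.1.1 then
        m.Sigma θ i.1.2 j.1.2 - m.Sigma θ i.1.2 (y j.1.1) - m.Sigma θ (y i.1.1) j.1.2
          + m.Sigma θ (y i.1.1) (y j.1.1)
      else 0

/-- The standardised upper limits `b`. -/
def limits (m : Param K p q d) (θ : EuclideanSpace ℝ (Fin d)) (A : Finset (Fin T))
    (y : A → Fin K) (x : Regressors T K p q) (i : DiffIdx A y) : ℝ :=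
  diffLimit m θ A y x i / √(diffCov m θ A y x i i)

/-- The correlation matrix `R` of the utility differences. -/
def corr (m : Param K p q d) (θ : EuclideanSpace ℝ (Fin d)) (A : Finset (Fin T))
    (y : A → Fin K) (x : Regressors T K p q) : Matrix (DiffIdx A y) (DiffIdx A y) ℝ :=
  Matrix.of fun i j =>
    diffCov m θ A y x i j / (√(diffCov m θ A y x i i) * √(diffCov m θ A y x j j))

/-- The orderings of the coordinates over which the approximation is averaged: for every set of
occasions and every choice pattern a nonempty finite set of enumerations. -/
structure Orderings (T K : ℕ) where
  set : ∀ (A : Finset (Fin T)) (y : A → Fin K),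
    Finset (Fin (Fintype.card (DiffIdx A y)) ≃ DiffIdx A y)
  nonempty : ∀ A y, (set A y).Nonempty

/-- The Solow-Joe approximation of `mnpProb`, averaged over the selected orderings. -/
def sjProb (m : Param K p q d) (o : Orderings T K) (θ : EuclideanSpace ℝ (Fin d))
    (A : Finset (Fin T)) (y : A → Fin K) (x : Regressors T K p q) : ℝ :=
  (∑ σ ∈ o.set A y,
      sjCDF (fun i => limits m θ A y x (σ i)) ((corr m θ A y x).submatrix σ σ)) /
    (o.set A y).card

/-- The approximated choice probabilities, normalised to sum to one. -/
def sjProbNormalized (m : Param K p q d) (o : Orderings T K) (θ : EuclideanSpace ℝ (Fin d))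
    (A : Finset (Fin T)) (y : A → Fin K) (x : Regressors T K p q) : ℝ :=
  sjProb m o θ A y x / ∑ y' : A → Fin K, sjProb m o θ A y' x

/-! ### Laws of the data, pairwise likelihood, regularity conditions -/

/-- Under `P`, the conditional probabilities, given the regressors, of the choices at the occasions
in `A` are given by `π`. -/
def HasChoiceProb (P : Measure (Observation T K p q)) (A : Finset (Fin T))
    (π : (A → Fin K) → Regressors T K p q → ℝ) : Prop :=
  ∀ (y : A → Fin K) (B : Set (Regressors T K p q)), MeasurableSet B →
    P {z | choicesOn A z.1 = y ∧ z.2 ∈ B} =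
      ∫⁻ x in B, ENNReal.ofReal (π y x) ∂(P.map Prod.snd)

/-- The data are generated by the multinomial probit model with parameter `θ`. -/
def GeneratedByMNP (m : Param K p q d) (θ : EuclideanSpace ℝ (Fin d))
    (P : Measure (Observation T K p q)) : Prop :=
  HasChoiceProb P Finset.univ (mnpProb m θ Finset.univ)

/-- The data are generated by a model implied by the Solow-Joe approximation with parameter `θ`:
the normalised approximated probabilities are the conditional choice probabilities, either of
the whole sequence of choices, or of each pair of choices. -/
def GeneratedBySJ (m : Param K p q d) (o : Orderings T K) (θ : EuclideanSpace ℝ (Fin d))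
    (P : Measure (Observation T K p q)) : Prop :=
  HasChoiceProb P Finset.univ (sjProbNormalized m o θ Finset.univ) ∨
    ∀ t t' : Fin T, t < t' → HasChoiceProb P {t, t'} (sjProbNormalized m o θ {t, t'})

/-- The pairwise composite marginal log-likelihood of one observation, for given choice
probabilities `π θ A y x`. -/
def lcml (π : EuclideanSpace ℝ (Fin d) → (A : Finset (Fin T)) → (A → Fin K) →
      Regressors T K p q → ℝ)
    (z : Observation T K p q) (θ : EuclideanSpace ℝ (Fin d)) : ℝ :=
  ∑ t : Fin T, ∑ t' ∈ Finset.Ioi t,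
    Real.log (π θ {t, t'} (choicesOn {t, t'} z.1) z.2)

/-- The regularity conditions at `θ₀` on a log-likelihood contribution `l z θ` under the data law
`P`: on a neighbourhood of `θ₀` it is three times continuously differentiable and all derivatives
up to order three are dominated by functions with finite mean, and the score at `θ₀` has finite
fourth moments. -/
structure ScoreConditions (P : Measure (Observation T K p q))
    (l : Observation T K p q → EuclideanSpace ℝ (Fin d) → ℝ)
    (θ₀ : EuclideanSpace ℝ (Fin d)) : Prop where
  smooth_dominated : ∃ V : Set (EuclideanSpace ℝ (Fin d)), IsOpen V ∧ θ₀ ∈ V ∧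
    (∀ᵐ z ∂P, ContDiffOn ℝ 3 (l z) V) ∧
    ∀ k ≤ 3, ∃ g : Observation T K p q → ℝ, Integrable g P ∧
      ∀ᵐ z ∂P, ∀ θ ∈ V, ‖iteratedFDeriv ℝ k (l z) θ‖ ≤ g z
  score_moment : MemLp (fun z => gradient (l z) θ₀) 4 P

end PanelProbit

end

/-! Everything reduces to joint smoothness in parameter and regressors plus compactness. The
regressors lie almost surely in a compact set `C`. If all pair probabilities are C³ in `(θ, x)` near
`{θ₀} × C` and positive there, so is their logarithm. Its derivatives are then bounded on a small
closed ball around `θ₀` times `C`: constants dominate, and the score is bounded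
(`scoreConditions_of_contDiffAt`, `scoreConditions_lcml`).

Smoothness comes from Gaussian orthant probabilities. Translating by the limit `b` fixes the domain
of integration, and the exponent becomes linear in `(S⁻¹, S⁻¹ b)`. This is an exponential family,
which can be differentiated under the integral (`contDiffAt_multivariateGaussian_real`).

Two nondegeneracy facts are needed. The utility differences have a positive definite covariance,
since each of them contains an error that no other one contains (`posDef_diffCov`). The Solow-Joe
matrices `Q_j` are invertible, since a Gaussian law of full support admits no nontrivial almost
surely constant combination of the indicators (`det_indCov_ne_zero`). Full support also makes the
probit probabilities positive. For the approximation, positivity is assumed on the support of the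
regressor law, a closed set, so `C` is intersected with it. -/

namespace PanelProbit

/-! ### Differentiation under the integral in exponential families -/

section ExponentialIntegral

variable {V : Type*}

/-- Growth slower than any exponential of the norm of the sufficient statistic `S`. -/
def SubExp {W F : Type*} [NormedAddCommGroup W] [NormedAddCommGroup F] (S : V → W) (f : V → F) :
    Prop :=
  ∀ δ > 0, ∃ C, ∀ v, ‖f v‖ ≤ C * Real.exp (δ * ‖S v‖)

/-- Half of the exponent absorbs the extra factor, by `t ≤ (2/δ) exp (δ t / 2)`. Each derivative in
`ξ` produces one such factor `S v`, so this stability drives the induction on the order. -/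
theorem SubExp.smulRight {Ξ F : Type*} [NormedAddCommGroup Ξ] [NormedSpace ℝ Ξ]
    [NormedAddCommGroup F] [NormedSpace ℝ F] {S : V → StrongDual ℝ Ξ} {f : V → F}
    (hf : SubExp S f) : SubExp S (fun v => (S v).smulRight (f v)) := by
  intro δ hδ
  obtain ⟨C, hC⟩ := hf (δ / 2) (by positivity)
  refine ⟨2 / δ * C, fun v => ?_⟩
  rw [ContinuousLinearMap.norm_smulRight_apply]
  have h1 : ‖S v‖ ≤ 2 / δ * Real.exp (δ / 2 * ‖S v‖) := by
    have := Real.add_one_le_exp (δ / 2 * ‖S v‖)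
    calc ‖S v‖ = 2 / δ * (δ / 2 * ‖S v‖) := by field_simp
      _ ≤ _ := by gcongr; linarith
  calc ‖S v‖ * ‖f v‖ ≤ (2 / δ * Real.exp (δ / 2 * ‖S v‖)) * (C * Real.exp (δ / 2 * ‖S v‖)) := by
        gcongr
        exact hC v
    _ = 2 / δ * C * (Real.exp (δ / 2 * ‖S v‖) * Real.exp (δ / 2 * ‖S v‖)) := by ring
    _ = _ := by rw [← Real.exp_add]; ring_nf

variable {Ξ F : Type*} [NormedAddCommGroup Ξ] [NormedSpace ℝ Ξ]
  [NormedAddCommGroup F] [NormedSpace ℝ F] {S : V → StrongDual ℝ Ξ} {ξ₀ : Ξ} {ε : ℝ}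

/-- The gap `ε - ‖ξ - ξ₀‖` is split in two halves: one for moving `ξ'` around `ξ`, one for the
growth of `f`. The resulting bound does not depend on `ξ'`, as dominated differentiation requires.
-/
theorem exp_mul_norm_le_of_subExp {f : V → F} (hf : SubExp S f) {ξ : Ξ}
    (hξ : ξ ∈ Metric.ball ξ₀ ε) :
    ∃ δ > 0, ∃ C, ∀ v, ∀ ξ' ∈ Metric.ball ξ δ,
      ‖Real.exp (S v ξ') • f v‖ ≤ C * Real.exp (S v ξ₀ + ε * ‖S v‖) := by
  rw [Metric.mem_ball, dist_eq_norm] at hξ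
  obtain ⟨C, hC⟩ := hf ((ε - ‖ξ - ξ₀‖) / 2) (by linarith)
  refine ⟨(ε - ‖ξ - ξ₀‖) / 2, by linarith, C, fun v ξ' hξ' => ?_⟩
  rw [Metric.mem_ball, dist_eq_norm] at hξ'
  have h1 : S v ξ' ≤ S v ξ₀ + (ε - (ε - ‖ξ - ξ₀‖) / 2) * ‖S v‖ := by
    have h2 : S v ξ' = S v ξ₀ + S v (ξ' - ξ₀) := by rw [map_sub]; ring
    have h3 : S v (ξ' - ξ₀) ≤ ‖S v‖ * ‖ξ' - ξ₀‖ :=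
      (le_abs_self _).trans ((S v).le_opNorm _)
    have h4 : ‖ξ' - ξ₀‖ ≤ ‖ξ' - ξ‖ + ‖ξ - ξ₀‖ := norm_sub_le_norm_sub_add_norm_sub _ _ _
    have h5 : ‖S v‖ * ‖ξ' - ξ₀‖ ≤ ‖S v‖ * (ε - (ε - ‖ξ - ξ₀‖) / 2) := by
      gcongr
      linarith
    linarith
  rw [norm_smul, Real.norm_eq_abs, abs_of_pos (Real.exp_pos _)]
  calc Real.exp (S v ξ') * ‖f v‖
      ≤ Real.exp (S v ξ₀ + (ε - (ε - ‖ξ - ξ₀‖) / 2) * ‖S v‖) *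
        (C * Real.exp ((ε - ‖ξ - ξ₀‖) / 2 * ‖S v‖)) := by
        gcongr
        exact hC v
    _ = C * (Real.exp (S v ξ₀ + (ε - (ε - ‖ξ - ξ₀‖) / 2) * ‖S v‖) *
        Real.exp ((ε - ‖ξ - ξ₀‖) / 2 * ‖S v‖)) := by ring
    _ = _ := by rw [← Real.exp_add]; ring_nf

variable [MeasurableSpace V] {μ : Measure V}

theorem aestronglyMeasurable_exp_smul {f : V → F} (hS : AEStronglyMeasurable S μ)
    (hf : AEStronglyMeasurable f μ) (ξ : Ξ) :
    AEStronglyMeasurable (fun v => Real.exp (S v ξ) • f v) μ :=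
  (Real.continuous_exp.comp_aestronglyMeasurable
    ((ContinuousLinearMap.apply ℝ ℝ ξ).continuous.comp_aestronglyMeasurable hS)).smul hf

theorem aestronglyMeasurable_smulRight {f : V → F} (hS : AEStronglyMeasurable S μ)
    (hf : AEStronglyMeasurable f μ) :
    AEStronglyMeasurable (fun v => (S v).smulRight (f v)) μ :=
  (ContinuousLinearMap.smulRightL ℝ Ξ F).aestronglyMeasurable_comp₂ hS hf

/-- Differentiation under the integral sign in an exponential family. -/
theorem hasFDerivAt_integral_exp_smul (hS : AEStronglyMeasurable S μ)
    (hint : Integrable (fun v => Real.exp (S v ξ₀ + ε * ‖S v‖)) μ) {f : V → F}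
    (hf : AEStronglyMeasurable f μ) (hfS : SubExp S f) {ξ : Ξ} (hξ : ξ ∈ Metric.ball ξ₀ ε) :
    HasFDerivAt (fun ξ => ∫ v, Real.exp (S v ξ) • f v ∂μ)
      (∫ v, Real.exp (S v ξ) • (S v).smulRight (f v) ∂μ) ξ := by
  obtain ⟨δ, hδ, C, hC⟩ := exp_mul_norm_le_of_subExp hfS hξ
  obtain ⟨δ', hδ', C', hC'⟩ := exp_mul_norm_le_of_subExp hfS.smulRight hξ
  refine hasFDerivAt_integral_of_dominated_of_fderiv_le
    (F' := fun ξ v => Real.exp (S v ξ) • (S v).smulRight (f v))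
    (bound := fun v => C' * Real.exp (S v ξ₀ + ε * ‖S v‖))
    (Metric.ball_mem_nhds ξ hδ') (.of_forall fun ξ' => aestronglyMeasurable_exp_smul hS hf ξ') ?_
    (aestronglyMeasurable_exp_smul hS (aestronglyMeasurable_smulRight hS hf) ξ)
    (.of_forall fun v => hC' v) (hint.const_mul C') (.of_forall fun v ξ' _ => ?_)
  · exact (hint.const_mul C).mono' (aestronglyMeasurable_exp_smul hS hf ξ)
      (.of_forall fun v => hC v ξ (Metric.mem_ball_self hδ))
  · have h := ((S v).hasFDerivAt (x := ξ')).exp.smul_const (f v)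
    convert h using 1
    ext η
    simp [smul_smul]

end ExponentialIntegral

/-- Integrals `∫ exp ⟨S v, ξ⟩ f v` are smooth in `ξ` in the interior of the natural parameter set. -/
theorem contDiffOn_integral_exp_smul {V : Type*} [MeasurableSpace V] {μ : Measure V}
    {Ξ : Type} [NormedAddCommGroup Ξ] [NormedSpace ℝ Ξ] {S : V → StrongDual ℝ Ξ} {ξ₀ : Ξ} {ε : ℝ}
    (hS : AEStronglyMeasurable S μ)
    (hint : Integrable (fun v => Real.exp (S v ξ₀ + ε * ‖S v‖)) μ) (n : ℕ) :
    ∀ {F : Type} [NormedAddCommGroup F] [NormedSpace ℝ F] {f : V → F},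
      AEStronglyMeasurable f μ → SubExp S f →
      ContDiffOn ℝ n (fun ξ => ∫ v, Real.exp (S v ξ) • f v ∂μ) (Metric.ball ξ₀ ε) := by
  -- The value space is quantified inside the induction because the derivative takes values in `Ξ
  -- →L[ℝ] F`. Keeping `Ξ` and `F` in `Type` leaves this space in the same universe.
  induction n with
  | zero =>
    intro F _ _ f hf hfS
    rw [Nat.cast_zero, contDiffOn_zero]
    exact fun ξ hξ =>
      (hasFDerivAt_integral_exp_smul hS hint hf hfS hξ).continuousAt.continuousWithinAt
  | succ n ih =>
    intro F _ _ f hf hfS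
    rw [Nat.cast_succ, contDiffOn_succ_iff_fderiv_of_isOpen Metric.isOpen_ball]
    refine ⟨fun ξ hξ => (hasFDerivAt_integral_exp_smul hS hint hf hfS
      hξ).differentiableAt.differentiableWithinAt, by simp, ?_⟩
    exact (ih (aestronglyMeasurable_smulRight hS hf) hfS.smulRight).congr fun ξ hξ =>
      (hasFDerivAt_integral_exp_smul hS hint hf hfS hξ).fderiv

/-! ### Exponentials of quadratic polynomials -/

section QuadraticExponential

variable {ι : Type} [Fintype ι]

/-- The sufficient statistic of the Gaussian family: `(A, c) ↦ - v' A v / 2 - v' c`. -/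
noncomputable def quadStat (v : EuclideanSpace ℝ ι) : StrongDual ℝ ((ι → ι → ℝ) × (ι → ℝ)) :=
  (∑ i, ∑ j, (-(v i * v j) / 2) • (ContinuousLinearMap.proj (R := ℝ) (φ := fun _ : ι => ℝ) j ∘L
      ContinuousLinearMap.proj (R := ℝ) (φ := fun _ : ι => ι → ℝ) i ∘L
        ContinuousLinearMap.fst ℝ _ _)) +
    ∑ i, (-v i) • (ContinuousLinearMap.proj (R := ℝ) (φ := fun _ : ι => ℝ) i ∘L
      ContinuousLinearMap.snd ℝ _ _)

theorem quadStat_apply (v : EuclideanSpace ℝ ι) (A : Matrix ι ι ℝ) (c : ι → ℝ) :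
    quadStat v (A, c) = -(v.ofLp ⬝ᵥ (A *ᵥ v.ofLp)) / 2 - v.ofLp ⬝ᵥ c := by
  simp only [quadStat, dotProduct, Matrix.mulVec, FunLike.coe_add,
    Pi.add_apply, FunLike.coe_sum, Finset.sum_apply, FunLike.coe_smul, Pi.smul_apply,
    ContinuousLinearMap.comp_apply, ContinuousLinearMap.proj_apply, ContinuousLinearMap.coe_fst',
    ContinuousLinearMap.coe_snd', smul_eq_mul, Finset.mul_sum, ← Finset.sum_neg_distrib,
    Finset.sum_div, neg_mul]
  rw [sub_eq_add_neg, ← Finset.sum_neg_distrib]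
  congr 1
  refine Finset.sum_congr rfl fun i _ => Finset.sum_congr rfl fun j _ => ?_
  change -(v i * v j) / 2 * A i j = _
  ring

theorem continuous_quadStat : Continuous (quadStat (ι := ι)) := by
  unfold quadStat
  fun_prop

theorem norm_quadStat_le : ∃ k > 0, ∀ v : EuclideanSpace ℝ ι,
    ‖quadStat v‖ ≤ k * (‖v‖ ^ 2 + ‖v‖) := by
  set n : ℝ := ((Fintype.card ι : ℕ) : ℝ) with hn
  have hv : ∀ (v : EuclideanSpace ℝ ι) i, |v i| ≤ ‖v‖ := fun v i => PiLp.norm_apply_le v i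
  -- There are `n ^ 2` quadratic and `n` linear terms; the summand `1` keeps the constant positive
  -- for an empty index type.
  refine ⟨n ^ 2 + n + 1, by positivity, fun v =>
    ContinuousLinearMap.opNorm_le_bound _ (by positivity) fun ξ => ?_⟩
  obtain ⟨A, c⟩ := ξ
  have hA : ∀ i j, |A i j| ≤ ‖(A, c)‖ := fun i j =>
    (norm_le_pi_norm (A i) j).trans ((norm_le_pi_norm A i).trans (le_max_left _ _))
  have hc : ∀ i, |c i| ≤ ‖(A, c)‖ := fun i => (norm_le_pi_norm c i).trans (le_max_right _ _)
  have h1 : |v.ofLp ⬝ᵥ (Matrix.of A *ᵥ v.ofLp)| ≤ n ^ 2 * (‖v‖ ^ 2 * ‖(A, c)‖) := by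
    simp only [dotProduct, Matrix.mulVec, Finset.mul_sum, Matrix.of_apply]
    refine (Finset.abs_sum_le_sum_abs _ _).trans ?_
    refine (Finset.sum_le_card_nsmul _ _ (n * (‖v‖ ^ 2 * ‖(A, c)‖)) fun i _ => ?_).trans ?_
    · refine (Finset.abs_sum_le_sum_abs _ _).trans ?_
      refine (Finset.sum_le_card_nsmul _ _ (‖v‖ ^ 2 * ‖(A, c)‖) fun j _ => ?_).trans ?_
      · rw [abs_mul, abs_mul]
        calc |v i| * (|A i j| * |v j|) ≤ ‖v‖ * (‖(A, c)‖ * ‖v‖) := by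
              gcongr
              exacts [hv v i, hA i j, hv v j]
          _ = _ := by ring
      · simp [n]
    · simp only [Finset.card_univ, nsmul_eq_mul]
      exact le_of_eq (by ring)
  have h2 : |v.ofLp ⬝ᵥ c| ≤ n * (‖v‖ * ‖(A, c)‖) := by
    simp only [dotProduct]
    refine (Finset.abs_sum_le_sum_abs _ _).trans ?_
    refine (Finset.sum_le_card_nsmul _ _ (‖v‖ * ‖(A, c)‖) fun i _ => ?_).trans ?_
    · rw [abs_mul]
      gcongr
      exacts [hv v i, hc i]
    · simp [n]
  have h3 : quadStat v (A, c) = -(v.ofLp ⬝ᵥ (Matrix.of A *ᵥ v.ofLp)) / 2 - v.ofLp ⬝ᵥ c :=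
    quadStat_apply v _ c
  rw [h3, Real.norm_eq_abs]
  calc |-(v.ofLp ⬝ᵥ (Matrix.of A *ᵥ v.ofLp)) / 2 - v.ofLp ⬝ᵥ c|
      ≤ |v.ofLp ⬝ᵥ (Matrix.of A *ᵥ v.ofLp)| + |v.ofLp ⬝ᵥ c| := by
        refine (abs_sub _ _).trans (add_le_add ?_ le_rfl)
        rw [abs_div, abs_neg]
        exact div_le_self (abs_nonneg _) (by norm_num)
    _ ≤ n ^ 2 * (‖v‖ ^ 2 * ‖(A, c)‖) + n * (‖v‖ * ‖(A, c)‖) := add_le_add h1 h2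
    _ ≤ (n ^ 2 + n + 1) * (‖v‖ ^ 2 + ‖v‖) * ‖(A, c)‖ := by
        have : 0 ≤ n := by positivity
        have e : (n ^ 2 + n + 1) * (‖v‖ ^ 2 + ‖v‖) * ‖(A, c)‖ =
          n ^ 2 * (‖v‖ ^ 2 * ‖(A, c)‖) + n * (‖v‖ * ‖(A, c)‖) +
          (n ^ 2 * (‖v‖ * ‖(A, c)‖) + n * (‖v‖ ^ 2 * ‖(A, c)‖) +
            (‖v‖ ^ 2 + ‖v‖) * ‖(A, c)‖) := by ring
        rw [e]
        exact le_add_of_nonneg_right (by positivity)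

theorem integrable_exp_neg_mul_sq_norm {a : ℝ} (ha : 0 < a) :
    Integrable (fun v : EuclideanSpace ℝ ι => Real.exp (-a * ‖v‖ ^ 2)) := by
  have h := GaussianFourier.integrable_cexp_neg_mul_sq_norm_add (V := EuclideanSpace ℝ ι)
    (b := (a : ℂ)) (by simpa using ha) 0 0
  convert h.norm using 2 with v
  simp only [Complex.norm_exp]
  congr 1
  simp [← Complex.ofReal_pow]

theorem exists_integrable_quadStat {A : Matrix ι ι ℝ} (c : ι → ℝ) {a : ℝ} (ha : 0 < a)
    (hA : ∀ v : EuclideanSpace ℝ ι, a * ‖v‖ ^ 2 ≤ v.ofLp ⬝ᵥ (A *ᵥ v.ofLp)) :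
    ∃ ε > 0, Integrable (fun v => Real.exp (quadStat v (A, c) + ε * ‖quadStat v‖)) := by
  obtain ⟨k, hk, hkv⟩ := norm_quadStat_le (ι := ι)
  -- The available decay is `a/2 * ‖v‖ ^ 2`. This `ε` spends `a/4` of it, and completing the square
  -- for the linear term `b * ‖v‖` spends `a/8`, which leaves `a/8`.
  set ε := a / (4 * k)
  have hε : ε * k = a / 4 := by simp only [ε]; field_simp
  set b := ‖WithLp.toLp 2 c‖ + a / 4
  have hb : 0 < b := by positivity
  refine ⟨ε, by positivity, ((integrable_exp_neg_mul_sq_norm (ι := ι)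
    (show 0 < a / 8 by positivity)).const_mul (Real.exp (2 * b ^ 2 / a))).mono' ?_
    (.of_forall fun v => ?_)⟩
  · refine (Continuous.aestronglyMeasurable ?_)
    have := continuous_quadStat (ι := ι)
    fun_prop
  · rw [Real.norm_eq_abs, abs_of_pos (Real.exp_pos _), ← Real.exp_add, Real.exp_le_exp,
      quadStat_apply]
    have h1 := hA v
    have h2 : -(v.ofLp ⬝ᵥ c) ≤ ‖v‖ * ‖WithLp.toLp 2 c‖ := by
      have := abs_real_inner_le_norm v (WithLp.toLp 2 c)
      rw [EuclideanSpace.inner_eq_star_dotProduct] at this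
      simp only [star_trivial] at this
      rw [dotProduct_comm]
      exact (neg_le_abs _).trans this
    have h3 : ε * ‖quadStat v‖ ≤ a / 4 * (‖v‖ ^ 2 + ‖v‖) := by
      rw [← hε, mul_assoc]
      gcongr
      exact hkv v
    have h4 : b * ‖v‖ ≤ a / 8 * ‖v‖ ^ 2 + 2 * b ^ 2 / a := by
      have : a / 8 * ‖v‖ ^ 2 + 2 * b ^ 2 / a - b * ‖v‖ = (a * ‖v‖ - 4 * b) ^ 2 / (8 * a) := by
        field_simp
        ring
      have : 0 ≤ (a * ‖v‖ - 4 * b) ^ 2 / (8 * a) := by positivity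
      linarith
    have h5 : b * ‖v‖ = ‖v‖ * ‖WithLp.toLp 2 c‖ + a / 4 * ‖v‖ := by simp only [b]; ring
    linarith

/-- Gaussian-type integrals over a fixed domain are smooth functions of the coefficients of the
quadratic polynomial in the exponent. -/
theorem contDiffAt_integral_exp_quadStat (n : ℕ) {A : Matrix ι ι ℝ} (c : ι → ℝ) {a : ℝ}
    (ha : 0 < a) (hA : ∀ v : EuclideanSpace ℝ ι, a * ‖v‖ ^ 2 ≤ v.ofLp ⬝ᵥ (A *ᵥ v.ofLp))
    (D : Set (EuclideanSpace ℝ ι)) :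
    ContDiffAt ℝ n (fun ξ : (ι → ι → ℝ) × (ι → ℝ) => ∫ v in D, Real.exp (quadStat v ξ)) (A, c) := by
  obtain ⟨ε, hε, hint⟩ := exists_integrable_quadStat c ha hA
  have h := contDiffOn_integral_exp_smul (μ := volume.restrict D)
    continuous_quadStat.aestronglyMeasurable hint.integrableOn n
    (f := fun _ => (1 : ℝ)) aestronglyMeasurable_const
    (fun δ hδ => ⟨1, fun v => by
      rw [norm_one, one_mul]
      exact Real.one_le_exp (by positivity)⟩)
  simp only [smul_eq_mul, mul_one] at h
  exact h.contDiffAt (Metric.ball_mem_nhds _ hε)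

end QuadraticExponential

/-! ### Entrywise smoothness of matrix operations -/

section MatrixSmoothness

variable {G : Type*} [NormedAddCommGroup G] [NormedSpace ℝ G] {κ : Type*} [Fintype κ]
  {n : WithTop ℕ∞} {e₀ : G}

theorem contDiffAt_det [DecidableEq κ] {S : G → Matrix κ κ ℝ}
    (hS : ∀ i j, ContDiffAt ℝ n (fun e => S e i j) e₀) :
    ContDiffAt ℝ n (fun e => (S e).det) e₀ := by
  simp only [Matrix.det_apply]
  exact ContDiffAt.sum fun σ _ => (contDiffAt_prod fun i _ => hS _ _).const_smul _

/-- Cramer's rule. Stating smoothness entry by entry avoids the choice of a matrix norm. -/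
theorem contDiffAt_matrix_inv [DecidableEq κ] {S : G → Matrix κ κ ℝ}
    (hS : ∀ i j, ContDiffAt ℝ n (fun e => S e i j) e₀) (h0 : (S e₀).det ≠ 0) (i j : κ) :
    ContDiffAt ℝ n (fun e => (S e)⁻¹ i j) e₀ := by
  simp only [Matrix.inv_def, Ring.inverse_eq_inv', Matrix.smul_apply, smul_eq_mul,
    Matrix.adjugate_apply]
  refine ((contDiffAt_det hS).inv h0).mul (contDiffAt_det fun k l => ?_)
  by_cases hk : k = j
  · subst hk
    simpa using contDiffAt_const
  · simpa [Matrix.updateRow_ne hk] using hS k l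

theorem contDiffAt_mulVec {κ' : Type*} {S : G → Matrix κ' κ ℝ} {b : G → κ → ℝ}
    (hS : ∀ i j, ContDiffAt ℝ n (fun e => S e i j) e₀)
    (hb : ∀ i, ContDiffAt ℝ n (fun e => b e i) e₀) (i : κ') :
    ContDiffAt ℝ n (fun e => (S e *ᵥ b e) i) e₀ := by
  simp only [Matrix.mulVec, dotProduct]
  exact ContDiffAt.sum fun j _ => (hS i j).mul (hb j)

theorem contDiffAt_dotProduct {a b : G → κ → ℝ}
    (ha : ∀ i, ContDiffAt ℝ n (fun e => a e i) e₀)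
    (hb : ∀ i, ContDiffAt ℝ n (fun e => b e i) e₀) :
    ContDiffAt ℝ n (fun e => a e ⬝ᵥ b e) e₀ := by
  simp only [dotProduct]
  exact ContDiffAt.sum fun j _ => (ha j).mul (hb j)

end MatrixSmoothness

/-! ### Gaussian densities and orthant probabilities -/

section Density

variable {ι : Type} [Fintype ι]

/-- The quadratic form attains a positive minimum on the unit sphere and is homogeneous of degree
two. An empty index type is separate because its sphere is empty. -/
theorem exists_mul_sq_norm_le {A : Matrix ι ι ℝ} (hA : A.PosDef) :
    ∃ a > 0, ∀ v : EuclideanSpace ℝ ι, a * ‖v‖ ^ 2 ≤ v.ofLp ⬝ᵥ (A *ᵥ v.ofLp) := by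
  cases isEmpty_or_nonempty ι with
  | inl h => exact ⟨1, one_pos, fun v => by simp [Subsingleton.elim v 0]⟩
  | inr h =>
    have hc : Continuous fun v : EuclideanSpace ℝ ι => v.ofLp ⬝ᵥ (A *ᵥ v.ofLp) := by
      simp only [dotProduct, Matrix.mulVec]
      fun_prop
    obtain ⟨u, hu, hmin⟩ := (isCompact_sphere (0 : EuclideanSpace ℝ ι) 1).exists_isMinOn
      (NormedSpace.sphere_nonempty.2 zero_le_one) hc.continuousOn
    have hu0 : u.ofLp ≠ 0 := by
      rintro h0
      have : u = 0 := by ext i; simp [h0]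
      simp [this] at hu
    refine ⟨_, by simpa using hA.dotProduct_mulVec_pos hu0, fun v => ?_⟩
    by_cases hv : v = 0
    · simp [hv]
    have hv' : ‖v‖ ≠ 0 := by simpa using hv
    have hmem : ‖v‖⁻¹ • v ∈ Metric.sphere (0 : EuclideanSpace ℝ ι) 1 := by
      simp [norm_smul, hv']
    have h1 := hmin hmem
    simp only [Set.mem_ofPred_eq, WithLp.ofLp_smul, Matrix.mulVec_smul, dotProduct_smul,
      smul_dotProduct, smul_eq_mul] at h1
    calc _ ≤ (‖v‖⁻¹ * (‖v‖⁻¹ * (v.ofLp ⬝ᵥ A *ᵥ v.ofLp))) * ‖v‖ ^ 2 := by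
          gcongr
      _ = _ := by field_simp

/-- Both sides are finite measures with the same characteristic function, by the Fourier transform
of the Gaussian kernel. -/
theorem stdGaussian_eq_withDensity :
    stdGaussian (EuclideanSpace ℝ ι) = volume.withDensity (fun x =>
      ENNReal.ofReal (((2 * Real.pi) ^ (Fintype.card ι / 2 : ℝ))⁻¹ * Real.exp (-‖x‖ ^ 2 / 2))) := by
  set C := ((2 * Real.pi) ^ (Fintype.card ι / 2 : ℝ))⁻¹ with hC
  have hpi : (0 : ℝ) < 2 * Real.pi := by positivity
  have hC0 : 0 ≤ C := by positivity
  have hint : Integrable (fun x : EuclideanSpace ℝ ι => C * Real.exp (-‖x‖ ^ 2 / 2)) := by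
    refine Integrable.const_mul ?_ C
    convert integrable_exp_neg_mul_sq_norm (ι := ι) (show (0 : ℝ) < 1 / 2 by norm_num) using 3
    ring
  have := isFiniteMeasure_withDensity_ofReal hint.2
  refine Measure.ext_of_charFun (E := EuclideanSpace ℝ ι) ?_
  ext t
  rw [charFun_stdGaussian, charFun_apply,
    integral_withDensity_eq_integral_toReal_smul₀ (by fun_prop) (by simp)]
  have h1 : ∀ x : EuclideanSpace ℝ ι,
      (ENNReal.ofReal (C * Real.exp (-‖x‖ ^ 2 / 2))).toReal •
        Complex.exp (inner ℝ x t * Complex.I) =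
      (C : ℂ) * Complex.exp (-(1 / 2 : ℂ) * ‖x‖ ^ 2 + Complex.I * inner ℝ t x) := by
    intro x
    rw [ENNReal.toReal_ofReal (by positivity), Complex.real_smul, Complex.ofReal_mul, mul_assoc,
      Complex.ofReal_exp, ← Complex.exp_add, real_inner_comm]
    congr 2
    push_cast
    ring
  simp_rw [h1]
  rw [integral_const_mul, GaussianFourier.integral_cexp_neg_mul_sq_norm_add_of_euclideanSpace
    (by norm_num)]
  have h2 : (C : ℂ) * ((Real.pi : ℂ) / (1 / 2)) ^ (Fintype.card ι / 2 : ℂ) = 1 := by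
    have : ((Real.pi : ℂ) / (1 / 2)) ^ (Fintype.card ι / 2 : ℂ) =
        (((2 * Real.pi) ^ (Fintype.card ι / 2 : ℝ) : ℝ) : ℂ) := by
      rw [Complex.ofReal_cpow hpi.le]
      congr 1
      · push_cast; ring
      · push_cast; ring
    rw [this, ← Complex.ofReal_mul, hC, inv_mul_cancel₀ (by positivity), Complex.ofReal_one]
  rw [← mul_assoc, h2, one_mul]
  congr 1
  rw [Complex.I_sq]
  ring

variable [DecidableEq ι]

open scoped MatrixOrder in
/-- A square root of a positive definite matrix which represents the associated Gaussian law. -/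
theorem exists_sqrt_multivariateGaussian {S : Matrix ι ι ℝ} (hS : S.PosDef) :
    ∃ R : Matrix ι ι ℝ, Rᵀ = R ∧ R * R = S ∧ multivariateGaussian 0 S =
      (stdGaussian (EuclideanSpace ℝ ι)).map (Matrix.toEuclideanCLM (𝕜 := ℝ) R) := by
  refine ⟨CFC.sqrt S, ?_, CFC.sqrt_mul_sqrt_self _ hS.posSemidef.nonneg, ?_⟩
  · have h := (CFC.sqrt_nonneg S).isSelfAdjoint
    rw [IsSelfAdjoint, Matrix.star_eq_conjTranspose, Matrix.conjTranspose_eq_transpose_of_trivial]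
      at h
    exact h
  · simp [multivariateGaussian]

/-- The standard law has a positive density, and the square root of `S` is invertible, so its linear
map is continuous and onto. -/
theorem isOpenPosMeasure_multivariateGaussian {S : Matrix ι ι ℝ} (hS : S.PosDef) :
    (multivariateGaussian 0 S).IsOpenPosMeasure := by
  obtain ⟨R, hR, hRR, hmap⟩ := exists_sqrt_multivariateGaussian hS
  have hunit : IsUnit R := by
    have h := hS.isUnit
    rw [← hRR] at h
    exact isUnit_of_mul_isUnit_left h
  have hstd : (stdGaussian (EuclideanSpace ℝ ι)).IsOpenPosMeasure := by
    rw [stdGaussian_eq_withDensity]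
    refine (withDensity_absolutelyContinuous' (by fun_prop)
      (.of_forall fun x => ?_)).isOpenPosMeasure
    exact (ENNReal.ofReal_pos.2 (by positivity)).ne'
  rw [hmap]
  refine (Matrix.toEuclideanCLM (𝕜 := ℝ) R).continuous.isOpenPosMeasure_map ?_
  obtain ⟨Q, hQ⟩ := hunit.exists_right_inv
  intro x
  refine ⟨Matrix.toEuclideanCLM (𝕜 := ℝ) Q x, ?_⟩
  rw [← mul_apply_eq_comp, ← map_mul, hQ, map_one, one_apply_eq_self]

/-- The Gaussian density. -/
theorem multivariateGaussian_real_eq_integral {S : Matrix ι ι ℝ} (hS : S.PosDef)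
    {E : Set (EuclideanSpace ℝ ι)} (hE : MeasurableSet E) :
    (multivariateGaussian 0 S).real E =
      ((2 * Real.pi) ^ (Fintype.card ι / 2 : ℝ))⁻¹ * (√S.det)⁻¹ *
        ∫ w in E, Real.exp (-(w.ofLp ⬝ᵥ (S⁻¹ *ᵥ w.ofLp)) / 2) := by
  obtain ⟨R, hR, hRR, hmap⟩ := exists_sqrt_multivariateGaussian hS
  have hstd := stdGaussian_eq_withDensity (ι := ι)
  set C := ((2 * Real.pi) ^ (Fintype.card ι / 2 : ℝ))⁻¹
  set B := Matrix.toEuclideanCLM (𝕜 := ℝ) R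
  have hC0 : 0 ≤ C := by positivity
  have hdet : R.det * R.det = S.det := by rw [← Matrix.det_mul, hRR]
  have hdet0 : R.det ≠ 0 := by
    intro h
    rw [h, zero_mul] at hdet
    exact hS.det_pos.ne hdet
  have hsq : √S.det = |R.det| := by rw [← hdet, Real.sqrt_mul_self_eq_abs]
  have hBdet : LinearMap.det (B : EuclideanSpace ℝ ι →ₗ[ℝ] EuclideanSpace ℝ ι) = R.det := by
    rw [Matrix.coe_toEuclideanCLM_eq_toEuclideanLin, Matrix.toEuclideanLin,
      Matrix.toLpLin_eq_toLin, LinearMap.det_toLin]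
  have hRSR : R * S⁻¹ * R = 1 := by
    have hu : IsUnit R.det := isUnit_iff_ne_zero.2 hdet0
    rw [← hRR, Matrix.mul_inv_rev, ← Matrix.mul_assoc, Matrix.mul_nonsing_inv _ hu,
      Matrix.one_mul, Matrix.nonsing_inv_mul _ hu]
  set h : EuclideanSpace ℝ ι → ℝ := fun w => Real.exp (-(w.ofLp ⬝ᵥ (S⁻¹ *ᵥ w.ofLp)) / 2)
  have hcont : Continuous h := by
    simp only [h, dotProduct, Matrix.mulVec]
    fun_prop
  have hnorm : ∀ z : EuclideanSpace ℝ ι, Real.exp (-‖z‖ ^ 2 / 2) = h (B z) := by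
    intro z
    simp only [h, B, Matrix.ofLp_toEuclideanCLM]
    congr 3
    rw [EuclideanSpace.real_norm_sq_eq, Matrix.dotProduct_mulVec, Matrix.vecMul_mulVec,
      Matrix.dotProduct_mulVec, Matrix.vecMul_vecMul, hR, hRSR, Matrix.vecMul_one, dotProduct]
    simp [sq]
  have hBE : MeasurableSet (B ⁻¹' E) := B.continuous.measurable hE
  rw [hmap, map_measureReal_apply B.continuous.measurable hE, hstd,
    Measure.real, withDensity_apply _ hBE, ← integral_toReal (by fun_prop) (by simp)]
  have hd : ∀ z : EuclideanSpace ℝ ι,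
      (ENNReal.ofReal (C * Real.exp (-‖z‖ ^ 2 / 2))).toReal = C * h (B z) := fun z => by
    rw [ENNReal.toReal_ofReal (by positivity), hnorm]
  simp_rw [hd]
  rw [integral_const_mul, ← setIntegral_map hE hcont.aestronglyMeasurable
    B.continuous.aemeasurable]
  -- The Jacobian: the image of Lebesgue measure under `B` carries the factor `|det R|⁻¹`, which is
  -- `(√S.det)⁻¹`.
  have := Measure.map_linearMap_addHaar_eq_smul_addHaar
    (f := (B : EuclideanSpace ℝ ι →ₗ[ℝ] EuclideanSpace ℝ ι)) volume (by rwa [hBdet])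
  rw [ContinuousLinearMap.coe_coe, hBdet] at this
  rw [this, Measure.restrict_smul, integral_smul_measure, ENNReal.toReal_ofReal (abs_nonneg _),
    smul_eq_mul, hsq, abs_inv, mul_assoc]

/-- Gaussian orthant probabilities as integrals over a fixed domain. -/
theorem multivariateGaussian_real_orthant {S : Matrix ι ι ℝ} (hS : S.PosDef) (s : Set ι)
    (b : ι → ℝ) :
    (multivariateGaussian 0 S).real {u | ∀ i ∈ s, u i ≤ b i} =
      ((2 * Real.pi) ^ (Fintype.card ι / 2 : ℝ))⁻¹ * (√S.det)⁻¹ *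
        (Real.exp (-(b ⬝ᵥ (S⁻¹ *ᵥ b)) / 2) *
          ∫ v in {v : EuclideanSpace ℝ ι | ∀ i ∈ s, v i ≤ 0},
            Real.exp (quadStat v ((S⁻¹ : Matrix ι ι ℝ), S⁻¹ *ᵥ b))) := by
  have hE : MeasurableSet {u : EuclideanSpace ℝ ι | ∀ i ∈ s, u i ≤ b i} := by
    simp only [Set.ofPred_forall]
    exact MeasurableSet.iInter fun i => MeasurableSet.iInter fun _ =>
      measurableSet_le (by fun_prop) measurable_const
  rw [multivariateGaussian_real_eq_integral hS hE]
  congr 1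
  rw [← integral_const_mul]
  -- Translation by `b` moves the limits into the integrand: the cross terms give the linear part
  -- `S⁻¹ *ᵥ b`, and the constant term is the factor in front.
  set β : EuclideanSpace ℝ ι := WithLp.toLp 2 b
  have hmp := measurePreserving_add_right (volume : Measure (EuclideanSpace ℝ ι)) β
  rw [← hmp.setIntegral_preimage_emb (MeasurableEquiv.addRight β).measurableEmbedding]
  have hpre : (fun x => x + β) ⁻¹' {u : EuclideanSpace ℝ ι | ∀ i ∈ s, u i ≤ b i} =
      {v | ∀ i ∈ s, v i ≤ 0} := by
    ext v
    simp [β]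
  rw [hpre]
  refine integral_congr_ae (.of_forall fun v => ?_)
  have hsymm : b ⬝ᵥ (S⁻¹ *ᵥ v.ofLp) = v.ofLp ⬝ᵥ (S⁻¹ *ᵥ b) := by
    have ht : (S⁻¹)ᵀ = S⁻¹ := by
      have := hS.inv.isHermitian
      rwa [Matrix.IsHermitian, Matrix.conjTranspose_eq_transpose_of_trivial] at this
    rw [Matrix.dotProduct_mulVec, ← Matrix.mulVec_transpose, ht, dotProduct_comm]
  simp only [β]
  rw [quadStat_apply, ← Real.exp_add, WithLp.ofLp_add, Matrix.mulVec_add, dotProduct_add,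
    add_dotProduct, add_dotProduct, hsymm]
  congr 1
  ring

theorem multivariateGaussian_real_orthant_pos {S : Matrix ι ι ℝ} (hS : S.PosDef) (b : ι → ℝ) :
    0 < (multivariateGaussian 0 S).real {u | ∀ i, u i ≤ b i} := by
  have := isOpenPosMeasure_multivariateGaussian hS
  have ho : IsOpen {u : EuclideanSpace ℝ ι | ∀ i, u i < b i} := by
    simp only [Set.ofPred_forall]
    exact isOpen_iInter_of_finite fun i => isOpen_lt (by fun_prop) continuous_const
  have hpos := ho.measure_pos (multivariateGaussian 0 S)
    ⟨WithLp.toLp 2 fun i => b i - 1, fun i => by simp⟩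
  exact ENNReal.toReal_pos (hpos.trans_le (measure_mono fun u hu i => (hu i).le)).ne'
    (measure_ne_top _ _)

/-- Gaussian orthant probabilities depend smoothly on the limits and on the covariance matrix. -/
theorem contDiffAt_multivariateGaussian_real {G : Type*} [NormedAddCommGroup G] [NormedSpace ℝ G]
    {n : ℕ} {e₀ : G} {S : G → Matrix ι ι ℝ} {b : G → ι → ℝ}
    (hS : ∀ i j, ContDiffAt ℝ n (fun e => S e i j) e₀)
    (hb : ∀ i, ContDiffAt ℝ n (fun e => b e i) e₀) (hpd : ∀ᶠ e in 𝓝 e₀, (S e).PosDef)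
    (s : Set ι) :
    ContDiffAt ℝ n
      (fun e => (multivariateGaussian 0 (S e)).real {u | ∀ i ∈ s, u i ≤ b e i}) e₀ := by
  refine ContDiffAt.congr_of_eventuallyEq ?_
    (hpd.mono fun e he => multivariateGaussian_real_orthant he s (b e))
  have hpd₀ := hpd.self_of_nhds
  have hinv := contDiffAt_matrix_inv hS hpd₀.det_pos.ne'
  have hc := contDiffAt_mulVec hinv hb
  have hdet := contDiffAt_det hS
  obtain ⟨a, ha, hA⟩ := exists_mul_sq_norm_le hpd₀.inv
  have hL := contDiffAt_integral_exp_quadStat n ((S e₀)⁻¹ *ᵥ b e₀) ha hA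
    {v : EuclideanSpace ℝ ι | ∀ i ∈ s, v i ≤ 0}
  have hpair : ContDiffAt ℝ n
      (F := (ι → ι → ℝ) × (ι → ℝ)) (fun e => (((S e)⁻¹ : Matrix ι ι ℝ), (S e)⁻¹ *ᵥ b e)) e₀ :=
    (contDiffAt_pi.2 fun i => contDiffAt_pi.2 fun j => hinv i j).prodMk (contDiffAt_pi.2 hc)
  refine (contDiffAt_const.mul ((hdet.sqrt hpd₀.det_pos.ne').inv ?_)).mul
    (((contDiffAt_dotProduct hb hc).neg.div_const 2).exp.mul ?_)
  · exact (Real.sqrt_pos.2 hpd₀.det_pos).ne'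
  · exact ContDiffAt.comp (g := fun ξ : (ι → ι → ℝ) × (ι → ℝ) =>
      ∫ v in {v : EuclideanSpace ℝ ι | ∀ i ∈ s, v i ≤ 0}, Real.exp (quadStat v ξ)) e₀ hL hpair

end Density

/-! ### Smoothness of the Solow-Joe approximation -/

section SolowJoe

variable {G : Type*} [NormedAddCommGroup G] [NormedSpace ℝ G] {n : ℕ} {e₀ : G} {D : ℕ}

theorem stdNormalCDF_eq_multivariateGaussian (s : ℝ) :
    stdNormalCDF s =
      (multivariateGaussian 0 (1 : Matrix Unit Unit ℝ)).real {u | ∀ i ∈ Set.univ, u i ≤ s} := by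
  have h := measurePreserving_eval_multivariateGaussian (μ := 0)
    (Matrix.PosSemidef.one (n := Unit) (R := ℝ)) (i := ())
  rw [stdNormalCDF, cdf_eq_real]
  have h2 : gaussianReal 0 1 = gaussianReal ((0 : EuclideanSpace ℝ Unit) ())
      ((1 : Matrix Unit Unit ℝ) () ()).toNNReal := by simp
  rw [h2, ← h.map_eq, map_measureReal_apply h.measurable measurableSet_Iic]
  congr 1
  ext u
  simp [Unique.forall_iff]

theorem contDiff_stdNormalCDF : ContDiff ℝ n stdNormalCDF := by
  rw [contDiff_iff_contDiffAt]
  intro s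
  simp_rw [funext stdNormalCDF_eq_multivariateGaussian]
  exact contDiffAt_multivariateGaussian_real (S := fun _ => 1) (b := fun s _ => s)
    (fun i j => contDiffAt_const) (fun i => contDiffAt_id) (.of_forall fun _ => .one) _

theorem measurableSet_coord_le (b : Fin D → ℝ) (i : Fin D) :
    MeasurableSet {v : EuclideanSpace ℝ (Fin D) | v i ≤ b i} :=
  measurableSet_le (by fun_prop) measurable_const

theorem memLp_ind (b : Fin D → ℝ) (i : Fin D) (μ : Measure (EuclideanSpace ℝ (Fin D)))
    [IsFiniteMeasure μ] : MemLp (ind b i) 2 μ :=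
  (memLp_const (1 : ℝ)).indicator (measurableSet_coord_le b i)

/-- The three probabilities are orthants of the full law `N(0, R)` constraining only some
coordinates, so no marginal laws are needed and the smoothness theorem applies as it stands. -/
theorem indCov_eq_sub (b : Fin D → ℝ) (R : Matrix (Fin D) (Fin D) ℝ) (i j : Fin D) :
    indCov b R i j =
      (multivariateGaussian 0 R).real {u | ∀ k ∈ ({i, j} : Set (Fin D)), u k ≤ b k} -
        (multivariateGaussian 0 R).real {u | ∀ k ∈ ({i} : Set (Fin D)), u k ≤ b k} *
          (multivariateGaussian 0 R).real {u | ∀ k ∈ ({j} : Set (Fin D)), u k ≤ b k} := by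
  rw [indCov, covariance_eq_sub (memLp_ind b i _) (memLp_ind b j _)]
  have h1 : ∀ k, (multivariateGaussian 0 R)[ind b k] =
      (multivariateGaussian 0 R).real {u | ∀ l ∈ ({k} : Set (Fin D)), u l ≤ b l} := fun k => by
    simp only [Set.mem_singleton_iff, forall_eq]
    exact integral_indicator_one (measurableSet_coord_le b k)
  rw [h1, h1]
  congr 1
  have h2 : ind b i * ind b j =
      Set.indicator {u | ∀ k ∈ ({i, j} : Set (Fin D)), u k ≤ b k} 1 := by
    ext u
    simp only [ind, Pi.mul_apply, Set.indicator_apply, Set.mem_ofPred_eq, Set.mem_insert_iff,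
      Set.mem_singleton_iff, forall_eq_or_imp, forall_eq, Pi.one_apply]
    split_ifs <;> simp_all
  rw [h2, integral_indicator_one]
  have : {u : EuclideanSpace ℝ (Fin D) | ∀ k ∈ ({i, j} : Set (Fin D)), u k ≤ b k} =
      {v | v i ≤ b i} ∩ {v | v j ≤ b j} := by
    ext u
    simp
  rw [this]
  exact (measurableSet_coord_le b i).inter (measurableSet_coord_le b j)

theorem contDiffAt_indCov {R : G → Matrix (Fin D) (Fin D) ℝ} {b : G → Fin D → ℝ}
    (hR : ∀ i j, ContDiffAt ℝ n (fun e => R e i j) e₀)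
    (hb : ∀ i, ContDiffAt ℝ n (fun e => b e i) e₀) (hpd : ∀ᶠ e in 𝓝 e₀, (R e).PosDef)
    (i j : Fin D) : ContDiffAt ℝ n (fun e => indCov (b e) (R e) i j) e₀ := by
  simp_rw [indCov_eq_sub]
  exact (contDiffAt_multivariateGaussian_real hR hb hpd _).sub
    ((contDiffAt_multivariateGaussian_real hR hb hpd _).mul
      (contDiffAt_multivariateGaussian_real hR hb hpd _))

/-- Under a nondegenerate Gaussian law an almost surely constant linear combination of the
indicators `1{u_i ≤ b_i}` is trivial. -/
theorem eq_zero_of_sum_ind_ae_eq_const {R : Matrix (Fin D) (Fin D) ℝ} (hR : R.PosDef)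
    (b : Fin D → ℝ) {κ : Type*} [Fintype κ] {f : κ → Fin D} (hf : f.Injective) (c : κ → ℝ) (m : ℝ)
    (h : ∀ᵐ u ∂(multivariateGaussian 0 R), ∑ i, c i * ind b (f i) u = m) (i : κ) : c i = 0 := by
  classical
  have := isOpenPosMeasure_multivariateGaussian hR
  -- By full support, an almost sure identity holds at some point of every nonempty open set.
  have key : ∀ U : Set (EuclideanSpace ℝ (Fin D)), IsOpen U → U.Nonempty →
      ∃ u ∈ U, ∑ i, c i * ind b (f i) u = m := by
    intro U hU hne
    by_contra! hcon
    exact (hU.measure_pos (multivariateGaussian 0 R) hne).ne'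
      (measure_mono_null (fun u hu => hcon u hu) h)
  have hlt : ∀ k, IsOpen {u : EuclideanSpace ℝ (Fin D) | u k < b k} := fun k =>
    isOpen_lt (by fun_prop) continuous_const
  have hgt : IsOpen {u : EuclideanSpace ℝ (Fin D) | b (f i) < u (f i)} :=
    isOpen_lt continuous_const (by fun_prop)
  obtain ⟨u₁, hu₁, h₁⟩ := key (⋂ k, {u | u k < b k}) (isOpen_iInter_of_finite hlt)
    ⟨WithLp.toLp 2 fun k => b k - 1, by simp⟩
  -- At `u₁` all indicators are one; at `u₂` only the one of `f i` vanishes, the others surviving by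
  -- injectivity of `f`. The two sums therefore differ by exactly `c i`.
  obtain ⟨u₂, ⟨hu₂, hu₂i⟩, h₂⟩ :=
    key ((⋂ k, ⋂ _ : k ≠ f i, {u | u k < b k}) ∩ {u | b (f i) < u (f i)})
    ((isOpen_iInter_of_finite fun k => isOpen_iInter_of_finite fun _ => hlt k).inter hgt)
    ⟨WithLp.toLp 2 fun k => if k = f i then b k + 1 else b k - 1, by
      simp +contextual⟩
  simp only [Set.mem_iInter, Set.mem_ofPred_eq] at hu₁ hu₂ hu₂i
  rw [← Finset.add_sum_erase _ _ (Finset.mem_univ i)] at h₁ h₂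
  have e₁ : ind b (f i) u₁ = 1 := by simp [ind, (hu₁ (f i)).le]
  have e₂ : ind b (f i) u₂ = 0 := by simp [ind, hu₂i]
  have e₃ : ∑ k ∈ Finset.univ.erase i, c k * ind b (f k) u₁ =
      ∑ k ∈ Finset.univ.erase i, c k * ind b (f k) u₂ := by
    refine Finset.sum_congr rfl fun k hk => ?_
    simp [ind, (hu₁ (f k)).le, (hu₂ (f k) (hf.ne (Finset.ne_of_mem_erase hk))).le]
  rw [e₁, e₃] at h₁
  rw [e₂] at h₂
  linarith

/-- The covariance matrix of the indicators `1{u_i ≤ b_i}` is nonsingular. -/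
theorem det_indCov_ne_zero {R : Matrix (Fin D) (Fin D) ℝ} (hR : R.PosDef) (b : Fin D → ℝ)
    {κ : Type*} [Fintype κ] [DecidableEq κ] {f : κ → Fin D} (hf : f.Injective) :
    (Matrix.of fun i l : κ => indCov b R (f i) (f l)).det ≠ 0 := by
  intro hdet
  obtain ⟨c, hc, hQc⟩ := Matrix.exists_mulVec_eq_zero_iff.2 hdet
  set μ := multivariateGaussian 0 R
  set X : EuclideanSpace ℝ (Fin D) → ℝ := fun u => ∑ i, c i * ind b (f i) u with hXdef
  have hX2 : ∀ i, MemLp (fun u => c i * ind b (f i) u) 2 μ := fun i =>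
    (memLp_ind b (f i) μ).const_mul (c i)
  have hX : MemLp X 2 μ := memLp_finsetSum _ fun i _ => hX2 i
  -- The variance of `X` is the quadratic form of the indicator covariances at the kernel vector
  -- `c`. Zero variance makes `X` almost surely constant.
  have hvar : Var[X; μ] = 0 := by
    rw [← covariance_self hX.aemeasurable, covariance_fun_sum_fun_sum hX2 hX2]
    have : ∀ i l, cov[fun u => c i * ind b (f i) u, fun u => c l * ind b (f l) u; μ] =
        c i * (indCov b R (f i) (f l) * c l) := fun i l => by
      rw [covariance_const_mul_left, covariance_const_mul_right, mul_comm (c l)]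
      rfl
    simp_rw [this, ← Finset.mul_sum]
    have hz : ∀ i, ∑ l, indCov b R (f i) (f l) * c l = 0 := fun i => congrFun hQc i
    simp [hz]
  exact hc (funext (eq_zero_of_sum_ind_ae_eq_const hR b hf c _
    (ae_eq_integral_of_variance_eq_zero hX hvar)))

theorem contDiffAt_sjFactor {R : G → Matrix (Fin D) (Fin D) ℝ} {b : G → Fin D → ℝ}
    (hR : ∀ i j, ContDiffAt ℝ n (fun e => R e i j) e₀)
    (hb : ∀ i, ContDiffAt ℝ n (fun e => b e i) e₀) (hpd : ∀ᶠ e in 𝓝 e₀, (R e).PosDef)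
    (j : Fin D) : ContDiffAt ℝ n (fun e => sjFactor (b e) (R e) j) e₀ := by
  have hcov := contDiffAt_indCov hR hb hpd
  have hcdf : ∀ i, ContDiffAt ℝ n (fun e => stdNormalCDF (b e i)) e₀ := fun i =>
    contDiff_stdNormalCDF.contDiffAt.comp e₀ (hb i)
  refine (hcdf j).add (contDiffAt_dotProduct (fun i => hcov j i) (contDiffAt_mulVec
    (contDiffAt_matrix_inv (fun i l => hcov i l) ?_) fun i => contDiffAt_const.sub (hcdf i)))
  exact det_indCov_ne_zero hpd.self_of_nhds _ Subtype.val_injective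

theorem contDiffAt_sjCDF {R : G → Matrix (Fin D) (Fin D) ℝ} {b : G → Fin D → ℝ}
    (hR : ∀ i j, ContDiffAt ℝ n (fun e => R e i j) e₀)
    (hb : ∀ i, ContDiffAt ℝ n (fun e => b e i) e₀) (hpd : ∀ᶠ e in 𝓝 e₀, (R e).PosDef) :
    ContDiffAt ℝ n (fun e => sjCDF (b e) (R e)) e₀ :=
  (contDiffAt_multivariateGaussian_real hR hb hpd {i | (i : ℕ) < 2}).mul
    (contDiffAt_prod fun j _ => contDiffAt_sjFactor hR hb hpd j)

end SolowJoe

variable {T K p q d : ℕ}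

/-! ### The law of the utility differences -/

section Differences

variable (A : Finset (Fin T)) (y : A → Fin K) (x : Regressors T K p q)

/-- Loadings of the utility differences on the random coefficients. -/
noncomputable def coefLoading : Matrix (DiffIdx A y) (Fin q) ℝ :=
  Matrix.of fun i => (x.2 i.1.1 i.1.2 - x.2 i.1.1 (y i.1.1)).ofLp

/-- Loadings of the utility differences on the errors at occasion `s`. -/
noncomputable def errorLoading (s : Fin T) : Matrix (DiffIdx A y) (Fin K) ℝ :=
  Matrix.of fun i => if (i.1.1 : Fin T) = s then Pi.single i.1.2 1 - Pi.single (y i.1.1) 1 else 0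

theorem errorLoading_self (i : DiffIdx A y) {s : Fin T} (h : (i.1.1 : Fin T) = s) :
    errorLoading A y s i = Pi.single i.1.2 1 - Pi.single (y i.1.1) 1 := if_pos h

theorem errorLoading_of_ne (i : DiffIdx A y) {s : Fin T} (h : (i.1.1 : Fin T) ≠ s) :
    errorLoading A y s i = 0 := if_neg h

theorem mul_mul_transpose_apply {ι κ : Type*} [Fintype κ] (N : Matrix ι κ ℝ) (M : Matrix κ κ ℝ)
    (i j : ι) : (N * M * Nᵀ) i j = N i ⬝ᵥ (M *ᵥ N j) := by
  rw [Matrix.mul_assoc, Matrix.mul_apply]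
  rfl

theorem diffCov_eq (m : Param K p q d) (θ : EuclideanSpace ℝ (Fin d)) :
    diffCov m θ A y x = coefLoading A y x * m.Omega θ * (coefLoading A y x)ᵀ +
      ∑ s, errorLoading A y s * m.Sigma θ * (errorLoading A y s)ᵀ := by
  ext i j
  rw [Matrix.add_apply, Matrix.sum_apply, mul_mul_transpose_apply]
  simp_rw [mul_mul_transpose_apply]
  simp only [diffCov, Matrix.of_apply, coefLoading]
  congr 1
  rw [Finset.sum_eq_single (i.1.1 : Fin T)]
  · rw [errorLoading_self A y i rfl]
    by_cases h : i.1.1 = j.1.1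
    · rw [if_pos h, errorLoading_self A y j (by rw [h])]
      simp only [Matrix.mulVec_sub, Matrix.mulVec_single_one, sub_dotProduct, dotProduct_sub,
        single_one_dotProduct, Matrix.col_apply]
      ring
    · rw [if_neg h, errorLoading_of_ne A y j fun h' => h (Subtype.ext h'.symm)]
      simp
  · intro s _ hs
    rw [errorLoading_of_ne A y i hs.symm, zero_dotProduct]
  · simp

theorem dotProduct_mul_mul_transpose_mulVec {ι κ : Type*} [Fintype ι] [Fintype κ]
    (N : Matrix ι κ ℝ) (M : Matrix κ κ ℝ) (v : ι → ℝ) :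
    v ⬝ᵥ ((N * M * Nᵀ) *ᵥ v) = (Nᵀ *ᵥ v) ⬝ᵥ (M *ᵥ (Nᵀ *ᵥ v)) := by
  rw [← Matrix.mulVec_mulVec, ← Matrix.mulVec_mulVec, Matrix.dotProduct_mulVec,
    ← Matrix.mulVec_transpose]

theorem dotProduct_diffCov_mulVec (m : Param K p q d) (θ : EuclideanSpace ℝ (Fin d))
    (v : DiffIdx A y → ℝ) :
    v ⬝ᵥ (diffCov m θ A y x *ᵥ v) =
      ((coefLoading A y x)ᵀ *ᵥ v) ⬝ᵥ (m.Omega θ *ᵥ ((coefLoading A y x)ᵀ *ᵥ v)) +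
        ∑ s, ((errorLoading A y s)ᵀ *ᵥ v) ⬝ᵥ (m.Sigma θ *ᵥ ((errorLoading A y s)ᵀ *ᵥ v)) := by
  rw [diffCov_eq, Matrix.add_mulVec, dotProduct_add, Matrix.sum_mulVec, dotProduct_sum]
  simp_rw [dotProduct_mul_mul_transpose_mulVec]

/-- The error of a non-chosen alternative enters only its own difference; the other differences at
that occasion contain their own errors and that of the chosen alternative. Hence the error loadings
determine `v`, which gives definiteness in `posDef_diffCov`. -/
theorem errorLoading_transpose_mulVec (v : DiffIdx A y → ℝ) (i : DiffIdx A y) :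
    ((errorLoading A y i.1.1)ᵀ *ᵥ v) i.1.2 = v i := by
  rw [Matrix.mulVec, dotProduct, Finset.sum_eq_single i]
  · simp [errorLoading, i.2]
  · intro j _ hj
    simp only [Matrix.transpose_apply, errorLoading, Matrix.of_apply]
    split_ifs with h
    · have h1 : j.1.1 = i.1.1 := Subtype.ext h
      have h2 : i.1.2 ≠ j.1.2 := fun h2 => hj (Subtype.ext (Prod.ext h1 h2.symm))
      have h3 : i.1.2 ≠ y j.1.1 := by
        rw [h1]
        exact i.2
      simp [h2, h3]
    · simp
  · simp

theorem posDef_diffCov (m : Param K p q d) (θ : EuclideanSpace ℝ (Fin d))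
    (hO : (m.Omega θ).PosSemidef) (hS : (m.Sigma θ).PosDef) : (diffCov m θ A y x).PosDef := by
  refine Matrix.PosDef.of_dotProduct_mulVec_pos ?_ fun v hv => ?_
  · rw [diffCov_eq]
    refine (Matrix.PosSemidef.add ?_ (Matrix.posSemidef_sum _ fun s _ => ?_)).isHermitian
    · simpa using hO.mul_mul_conjTranspose_same (coefLoading A y x)
    · simpa using hS.posSemidef.mul_mul_conjTranspose_same (errorLoading A y s)
  · rw [star_trivial, dotProduct_diffCov_mulVec]
    obtain ⟨i, hi⟩ := Function.ne_iff.1 hv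
    refine add_pos_of_nonneg_of_pos (by simpa only [star_trivial] using hO.dotProduct_mulVec_nonneg _)
      (Finset.sum_pos' (fun s _ => by
        simpa only [star_trivial] using hS.posSemidef.dotProduct_mulVec_nonneg _)
        ⟨i.1.1, Finset.mem_univ _, ?_⟩)
    have h0 : (errorLoading A y i.1.1)ᵀ *ᵥ v ≠ 0 := fun h0 =>
      hi (by rw [← errorLoading_transpose_mulVec A y v i, h0]; rfl)
    simpa only [star_trivial] using hS.dotProduct_mulVec_pos h0

/-- The centred utility differences. -/
noncomputable def noiseDiff (w : EuclideanSpace ℝ (Fin q) × (Fin T → EuclideanSpace ℝ (Fin K))) :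
    EuclideanSpace ℝ (DiffIdx A y) :=
  WithLp.toLp 2 fun i => inner ℝ (x.2 i.1.1 i.1.2 - x.2 i.1.1 (y i.1.1)) w.1 +
    (w.2 i.1.1 i.1.2 - w.2 i.1.1 (y i.1.1))

theorem measurable_noiseDiff : Measurable (noiseDiff A y x) := by
  unfold noiseDiff
  fun_prop

theorem inner_noiseDiff (w : EuclideanSpace ℝ (Fin q) × (Fin T → EuclideanSpace ℝ (Fin K)))
    (v : EuclideanSpace ℝ (DiffIdx A y)) :
    inner ℝ (noiseDiff A y x w) v =
      inner ℝ w.1 (WithLp.toLp 2 ((coefLoading A y x)ᵀ *ᵥ v.ofLp)) +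
        ∑ s, inner ℝ (w.2 s) (WithLp.toLp 2 ((errorLoading A y s)ᵀ *ᵥ v.ofLp)) := by
  simp only [EuclideanSpace.inner_eq_star_dotProduct, star_trivial]
  have h1 : ∀ {κ : Type} [Fintype κ] (N : Matrix (DiffIdx A y) κ ℝ) (u : κ → ℝ),
      (Nᵀ *ᵥ v.ofLp) ⬝ᵥ u = v.ofLp ⬝ᵥ fun i => N i ⬝ᵥ u := fun N u => by
    rw [Matrix.mulVec_transpose, ← Matrix.dotProduct_mulVec]
    rfl
  simp_rw [h1]
  rw [← dotProduct_sum, ← dotProduct_add]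
  congr 1
  ext i
  simp only [noiseDiff, Pi.add_apply, Finset.sum_apply]
  congr 1
  · rw [EuclideanSpace.inner_eq_star_dotProduct, star_trivial, dotProduct_comm]
    rfl
  · rw [Finset.sum_eq_single (i.1.1 : Fin T)]
    · simp [errorLoading_self A y i rfl, sub_dotProduct]
    · intro s _ hs
      rw [errorLoading_of_ne A y i hs.symm, zero_dotProduct]
    · simp

/-- By independence the characteristic function factorises over the random coefficients and the
occasions, and the quadratic forms in the exponents add up to that of `diffCov`. -/
theorem map_noiseDiff (m : Param K p q d) (θ : EuclideanSpace ℝ (Fin d))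
    (hO : (m.Omega θ).PosSemidef) (hS : (m.Sigma θ).PosDef) :
    (noiseLaw T m θ).map (noiseDiff A y x) = multivariateGaussian 0 (diffCov m θ A y x) := by
  have : IsProbabilityMeasure (noiseLaw T m θ) := by
    unfold noiseLaw
    infer_instance
  have := Measure.isProbabilityMeasure_map (μ := noiseLaw T m θ)
    (measurable_noiseDiff A y x).aemeasurable
  refine Measure.ext_of_charFun (E := EuclideanSpace ℝ (DiffIdx A y)) ?_
  ext v
  rw [charFun_multivariateGaussian (posDef_diffCov A y x m θ hO hS).posSemidef, charFun_apply,
    integral_map (measurable_noiseDiff A y x).aemeasurable (by fun_prop)]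
  simp_rw [inner_noiseDiff, Complex.ofReal_add, Complex.ofReal_sum, add_mul, Finset.sum_mul,
    Complex.exp_add, Complex.exp_sum]
  rw [noiseLaw, integral_prod_mul
    (fun a => Complex.exp
      (((inner ℝ a (WithLp.toLp 2 ((coefLoading A y x)ᵀ *ᵥ v.ofLp)) : ℝ) : ℂ) * Complex.I))
    (fun u : Fin T → EuclideanSpace ℝ (Fin K) => ∏ s, Complex.exp
      (((inner ℝ (u s) (WithLp.toLp 2 ((errorLoading A y s)ᵀ *ᵥ v.ofLp)) : ℝ) : ℂ) * Complex.I)),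
    integral_fintype_prod_eq_prod (f := fun s (u : EuclideanSpace ℝ (Fin K)) => Complex.exp
      (((inner ℝ u (WithLp.toLp 2 ((errorLoading A y s)ᵀ *ᵥ v.ofLp)) : ℝ) : ℂ) * Complex.I))]
  simp_rw [← charFun_apply, charFun_multivariateGaussian hO,
    charFun_multivariateGaussian hS.posSemidef, ← Complex.exp_sum, ← Complex.exp_add]
  congr 1
  rw [dotProduct_diffCov_mulVec]
  simp only [inner_zero_right, Complex.ofReal_zero, zero_mul, zero_sub, Complex.ofReal_add,
    Complex.ofReal_sum, Finset.sum_neg_distrib, ← Finset.sum_div]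
  ring

theorem mnpProb_eq (m : Param K p q d) (θ : EuclideanSpace ℝ (Fin d))
    (hO : (m.Omega θ).PosSemidef) (hS : (m.Sigma θ).PosDef) :
    mnpProb m θ A y x = (multivariateGaussian 0 (diffCov m θ A y x)).real
      {u | ∀ i ∈ Set.univ, u i ≤ diffLimit m θ A y x i} := by
  have hE : MeasurableSet {u : EuclideanSpace ℝ (DiffIdx A y) |
      ∀ i ∈ Set.univ, u i ≤ diffLimit m θ A y x i} := by
    simp only [Set.ofPred_forall]
    exact MeasurableSet.iInter fun i => MeasurableSet.iInter fun _ =>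
      measurableSet_le (by fun_prop) measurable_const
  rw [← map_noiseDiff A y x m θ hO hS, map_measureReal_apply (measurable_noiseDiff A y x) hE,
    mnpProb]
  congr 1
  ext w
  have hi : ∀ (t : A) (k : Fin K),
      utility (m.beta θ) x w t k ≤ utility (m.beta θ) x w t (y t) ↔
        inner ℝ (x.2 t k - x.2 t (y t)) w.1 + (w.2 t k - w.2 t (y t)) ≤
          inner ℝ (x.1 t (y t) - x.1 t k) (m.beta θ) := fun t k => by
    simp only [utility, inner_sub_left]
    constructor <;> intro h <;> linarith
  simp only [Set.mem_ofPred_eq, Set.mem_preimage, Set.mem_univ, true_imp_iff, noiseDiff, diffLimit]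
  constructor
  · exact fun h i => (hi i.1.1 i.1.2).1 (h i.1.1 i.1.2)
  · intro h t k
    -- Comparing the chosen alternative with itself is vacuous, which is why `DiffIdx` can omit it.
    by_cases hk : k = y t
    · rw [hk]
    · exact (hi t k).2 (h ⟨(t, k), hk⟩)

theorem mnpProb_pos (m : Param K p q d) (θ : EuclideanSpace ℝ (Fin d))
    (hO : (m.Omega θ).PosSemidef) (hS : (m.Sigma θ).PosDef) : 0 < mnpProb m θ A y x := by
  rw [mnpProb_eq A y x m θ hO hS]
  simpa using multivariateGaussian_real_orthant_pos (posDef_diffCov A y x m θ hO hS)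
    (diffLimit m θ A y x)

/-- Standardisation is a congruence by an invertible diagonal matrix, so it preserves positive
definiteness. -/
theorem corr_eq (m : Param K p q d) (θ : EuclideanSpace ℝ (Fin d)) :
    corr m θ A y x = Matrix.diagonal (fun i => (√(diffCov m θ A y x i i))⁻¹) *
      diffCov m θ A y x * (Matrix.diagonal fun i => (√(diffCov m θ A y x i i))⁻¹)ᴴ := by
  ext i j
  simp [corr, div_eq_mul_inv]
  ring

theorem posDef_corr (m : Param K p q d) (θ : EuclideanSpace ℝ (Fin d))
    (hO : (m.Omega θ).PosSemidef) (hS : (m.Sigma θ).PosDef) : (corr m θ A y x).PosDef := by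
  have h := posDef_diffCov A y x m θ hO hS
  rw [corr_eq]
  refine h.mul_mul_conjTranspose_same ?_
  refine Matrix.vecMul_injective_of_isUnit ?_
  rw [Matrix.isUnit_iff_isUnit_det, Matrix.det_diagonal, isUnit_iff_ne_zero,
    Finset.prod_ne_zero_iff]
  exact fun i _ => inv_ne_zero (Real.sqrt_pos.2 h.diag_pos).ne'

end Differences

/-! ### From joint smoothness to uniform derivative bounds -/

section PartialDerivatives

variable {E X F : Type*} [NormedAddCommGroup E] [NormedSpace ℝ E] [NormedAddCommGroup X]
  [NormedSpace ℝ X] [NormedAddCommGroup F] [NormedSpace ℝ F]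

/-- Freezing `x` is a translation composed with the linear inclusion `inl`. The former preserves
derivatives, and the latter has norm at most one. -/
theorem norm_iteratedFDeriv_partial_le {f : E × X → F} {n : ℕ} {θ : E} {x : X}
    (hf : ContDiffAt ℝ n f (θ, x)) {k : ℕ} (hk : k ≤ n) :
    ‖iteratedFDeriv ℝ k (fun θ => f (θ, x)) θ‖ ≤ ‖iteratedFDeriv ℝ k f (θ, x)‖ := by
  obtain ⟨u, hu, hfu⟩ := hf.contDiffOn le_rfl (by simp)
  obtain ⟨v, hvu, hv, hxv⟩ := mem_nhds_iff.1 hu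
  have hfv : ContDiffOn ℝ n f v := hfu.mono hvu
  set g : E × X → F := fun p => f (p + (0, x)) with hg
  set s : Set (E × X) := (fun p => p + ((0 : E), x)) ⁻¹' v
  have hs : IsOpen s := hv.preimage (by fun_prop)
  have hgs : ContDiffOn ℝ n g s :=
    hfv.comp (t := v) (ContDiff.contDiffOn (by fun_prop)) (Set.mapsTo_preimage _ _)
  have hfun : (fun θ => f (θ, x)) = g ∘ ContinuousLinearMap.inl ℝ E X := by
    ext θ'
    simp [hg]
  have hmem : ContinuousLinearMap.inl ℝ E X θ ∈ s := by simpa [s] using hxv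
  have ho : IsOpen (ContinuousLinearMap.inl ℝ E X ⁻¹' s) :=
    hs.preimage (ContinuousLinearMap.inl ℝ E X).continuous
  have h := (ContinuousLinearMap.inl ℝ E X).iteratedFDerivWithin_comp_right hgs hs.uniqueDiffOn
    ho.uniqueDiffOn hmem (i := k) (by exact_mod_cast hk)
  rw [iteratedFDerivWithin_of_isOpen k ho hmem, iteratedFDerivWithin_of_isOpen k hs hmem] at h
  have hgf : iteratedFDeriv ℝ k g (ContinuousLinearMap.inl ℝ E X θ) =
      iteratedFDeriv ℝ k f (θ, x) := by
    rw [hg, iteratedFDeriv_comp_add_right]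
    simp
  rw [hfun, h, hgf]
  refine (ContinuousMultilinearMap.norm_compContinuousLinearMap_le _ _).trans ?_
  refine mul_le_of_le_one_right (norm_nonneg _) (Finset.prod_le_one (fun _ _ => norm_nonneg _)
    fun _ _ => ?_)
  exact ContinuousLinearMap.norm_inl_le_one ℝ E X

end PartialDerivatives

/-- A finite family of contributions which are jointly three times continuously differentiable in
the parameter and the regressors near a compact set of regressors has uniformly bounded
derivatives. -/
theorem exists_forall_norm_iteratedFDeriv_le {E X F : Type*} [NormedAddCommGroup E]
    [NormedSpace ℝ E] [ProperSpace E] [NormedAddCommGroup X] [NormedSpace ℝ X]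
    [NormedAddCommGroup F] [NormedSpace ℝ F] {Y : Type*} [Fintype Y] {f : Y → E × X → F} {n : ℕ}
    {θ₀ : E} {C : Set X} (hC : IsCompact C) (hf : ∀ y, ∀ x ∈ C, ContDiffAt ℝ n (f y) (θ₀, x)) :
    ∃ r > 0, (∀ y, ∀ θ ∈ Metric.ball θ₀ r, ∀ x ∈ C, ContDiffAt ℝ n (fun θ => f y (θ, x)) θ) ∧
      ∀ k ≤ n, ∃ M : ℝ, ∀ y, ∀ θ ∈ Metric.ball θ₀ r, ∀ x ∈ C,
        ‖iteratedFDeriv ℝ k (fun θ => f y (θ, x)) θ‖ ≤ M := by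
  set W : Set (E × X) := ⋂ y, {a | ContDiffAt ℝ n (f y) a}
  have hW : IsOpen W := isOpen_iInter_of_finite fun y =>
    isOpen_iff_mem_nhds.2 fun a ha => ContDiffAt.eventually ha (by simp)
  have hCW : ({θ₀} : Set E) ×ˢ C ⊆ W := by
    rintro ⟨θ, x⟩ ⟨rfl, hx⟩
    exact Set.mem_iInter.2 fun y => hf y x hx
  -- The tube lemma gives one neighbourhood of `θ₀` serving all regressors in `C`.
  obtain ⟨U, V, hU, -, hθU, hCV, hUV⟩ := generalized_tube_lemma isCompact_singleton hC hW hCW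
  obtain ⟨r, hr, hrU⟩ := Metric.nhds_basis_closedBall.mem_iff.1
    (hU.mem_nhds (hθU (Set.mem_singleton θ₀)))
  have hsmooth : ∀ y, ∀ θ ∈ Metric.closedBall θ₀ r, ∀ x ∈ C, ContDiffAt ℝ n (f y) (θ, x) :=
    fun y θ hθ x hx => Set.mem_iInter.1 (hUV ⟨hrU hθ, hCV hx⟩) y
  have hcomp : IsCompact (Metric.closedBall θ₀ r ×ˢ C) := (isCompact_closedBall θ₀ r).prod hC
  refine ⟨r, hr, fun y θ hθ x hx => ?_, fun k hk => ?_⟩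
  · exact ContDiffAt.comp θ (g := f y) (f := fun θ => (θ, x))
      (hsmooth y θ (Metric.ball_subset_closedBall hθ) x hx) (by fun_prop)
  · have hy : ∀ y, ∃ M : ℝ, ∀ a ∈ Metric.closedBall θ₀ r ×ˢ C,
        ‖iteratedFDeriv ℝ k (f y) a‖ ≤ M := fun y =>
      hcomp.exists_bound_of_continuousOn fun a ha =>
        ((hsmooth y a.1 ha.1 a.2 ha.2).iteratedFDeriv_right (m := 0) (i := k)
          (by rw [zero_add]; exact_mod_cast hk)).continuousAt.continuousWithinAt
    choose M hM using hy
    refine ⟨∑ y, |M y|, fun y θ hθ x hx => ?_⟩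
    have hθ' := Metric.ball_subset_closedBall hθ
    exact (norm_iteratedFDeriv_partial_le (hsmooth y θ hθ' x hx) hk).trans
      ((hM y (θ, x) ⟨hθ', hx⟩).trans ((le_abs_self _).trans
        (Finset.single_le_sum (f := fun y => |M y|) (fun _ _ => abs_nonneg _)
          (Finset.mem_univ y))))

theorem continuousOn_gradient_partial {E X : Type*} [NormedAddCommGroup E] [InnerProductSpace ℝ E]
    [CompleteSpace E] [NormedAddCommGroup X] [NormedSpace ℝ X] {f : E × X → ℝ} {θ₀ : E} {C : Set X}
    {n : WithTop ℕ∞} (hn : 1 ≤ n) (hf : ∀ x ∈ C, ContDiffAt ℝ n f (θ₀, x)) :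
    ContinuousOn (fun x => gradient (fun θ => f (θ, x)) θ₀) C := by
  have hgrad : ∀ x ∈ C, gradient (fun θ => f (θ, x)) θ₀ =
      (InnerProductSpace.toDual ℝ E).symm
        ((fderiv ℝ f (θ₀, x)).comp (ContinuousLinearMap.inl ℝ E X)) := by
    intro x hx
    rw [gradient]
    congr 1
    have h1 := ((hf x hx).differentiableAt (zero_lt_one.trans_le hn).ne').hasFDerivAt
    exact (h1.comp θ₀ (hasFDerivAt_prodMk_left θ₀ x)).fderiv
  refine ContinuousOn.congr (fun x hx => ?_) hgrad
  have h1 : ContinuousAt (fderiv ℝ f) (θ₀, x) :=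
    ((hf x hx).fderiv_right (m := 0) (by simpa using hn)).continuousAt
  have h2 : ContinuousAt (fun x => fderiv ℝ f (θ₀, x)) x :=
    ContinuousAt.comp (f := fun x => (θ₀, x)) h1 (by fun_prop)
  exact ((InnerProductSpace.toDual ℝ E).symm.continuous.continuousAt.comp
    (h2.clm_comp continuousAt_const)).continuousWithinAt

/-- With countably many choice patterns, measurability can be checked for each of them; extending by
zero off `C` changes the function only on a null set. -/
theorem aestronglyMeasurable_of_forall_continuousOn {Y X F : Type*} [Countable Y]
    [MeasurableSpace Y] [MeasurableSingletonClass Y] [MeasurableSpace X] [TopologicalSpace X]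
    [OpensMeasurableSpace X] [NormedAddCommGroup F] [MeasurableSpace F] [BorelSpace F]
    [SecondCountableTopology F] {P : Measure (Y × X)} {C : Set X} (hC : MeasurableSet C)
    (hP : ∀ᵐ z ∂P, z.2 ∈ C) {f : Y → X → F} (hf : ∀ y, ContinuousOn (f y) C) :
    AEStronglyMeasurable (fun z => f z.1 z.2) P := by
  classical
  have hm : Measurable fun z : Y × X => C.indicator (f z.1) z.2 :=
    measurable_from_prod_countable_right fun y => by
      simp only [← Set.piecewise_eq_indicator]
      exact (hf y).measurable_piecewise continuousOn_const hC
  refine ⟨_, hm.stronglyMeasurable, ?_⟩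
  filter_upwards [hP] with z hz
  rw [Set.indicator_of_mem hz]

/-- A contribution which is jointly three times continuously differentiable in the parameter and
the regressors satisfies the regularity conditions if the regressors stay in a compact set. -/
theorem scoreConditions_of_contDiffAt (P : Measure (Observation T K p q)) [IsProbabilityMeasure P]
    {F : (Fin T → Fin K) → EuclideanSpace ℝ (Fin d) × Regressors T K p q → ℝ}
    {θ₀ : EuclideanSpace ℝ (Fin d)} {C : Set (Regressors T K p q)} (hC : IsCompact C)
    (hP : ∀ᵐ z ∂P, z.2 ∈ C) (hF : ∀ y, ∀ x ∈ C, ContDiffAt ℝ (3 : ℕ) (F y) (θ₀, x)) :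
    ScoreConditions P (fun z θ => F z.1 (θ, z.2)) θ₀ := by
  obtain ⟨r, hr, hsmooth, hbound⟩ := exists_forall_norm_iteratedFDeriv_le hC hF
  refine ⟨⟨Metric.ball θ₀ r, Metric.isOpen_ball, Metric.mem_ball_self hr, ?_, fun k hk => ?_⟩, ?_⟩
  · filter_upwards [hP] with z hz θ hθ
    exact (hsmooth z.1 θ hθ z.2 hz).contDiffWithinAt
  · obtain ⟨M, hM⟩ := hbound k hk
    refine ⟨fun _ => M, integrable_const M, ?_⟩
    filter_upwards [hP] with z hz θ hθ
    exact hM z.1 θ hθ z.2 hz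
  · obtain ⟨M, hM⟩ := hbound 1 (by norm_num)
    refine MemLp.of_bound (aestronglyMeasurable_of_forall_continuousOn hC.measurableSet hP
      (f := fun y x => gradient (fun θ => F y (θ, x)) θ₀)
      fun y => continuousOn_gradient_partial (by norm_num) (hF y)) M ?_
    filter_upwards [hP] with z hz
    have := hM z.1 θ₀ (Metric.mem_ball_self hr) z.2 hz
    rwa [norm_iteratedFDeriv_one, ← LinearIsometryEquiv.norm_map
      (InnerProductSpace.toDual ℝ (EuclideanSpace ℝ (Fin d))).symm] at this

/-! ### Joint smoothness of the choice probabilities -/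

section JointSmoothness

variable {m : Param K p q d} {n : ℕ} {θ₀ : EuclideanSpace ℝ (Fin d)}

/-- The parametrisation is smooth, with admissible values, near `θ₀`. -/
structure RegularAt (m : Param K p q d) (n : ℕ) (θ₀ : EuclideanSpace ℝ (Fin d)) : Prop where
  beta : ContDiffAt ℝ n m.beta θ₀
  Omega : ∀ i j, ContDiffAt ℝ n (fun θ => m.Omega θ i j) θ₀
  Sigma : ∀ i j, ContDiffAt ℝ n (fun θ => m.Sigma θ i j) θ₀
  posSemidef : ∀ᶠ θ in 𝓝 θ₀, (m.Omega θ).PosSemidef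
  posDef : ∀ᶠ θ in 𝓝 θ₀, (m.Sigma θ).PosDef

variable (x₀ : Regressors T K p q) (A : Finset (Fin T)) (y : A → Fin K)

theorem RegularAt.contDiffAt_diffLimit (h : RegularAt m n θ₀) (i : DiffIdx A y) :
    ContDiffAt ℝ n (fun a : EuclideanSpace ℝ (Fin d) × Regressors T K p q =>
      diffLimit m a.1 A y a.2 i) (θ₀, x₀) := by
  have hb : ContDiffAt ℝ n (fun a : EuclideanSpace ℝ (Fin d) × Regressors T K p q => m.beta a.1)
    (θ₀, x₀) := h.beta.comp (θ₀, x₀) contDiffAt_fst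
  exact ContDiffAt.inner ℝ (by fun_prop) hb

theorem RegularAt.contDiffAt_diffCov (h : RegularAt m n θ₀) (i j : DiffIdx A y) :
    ContDiffAt ℝ n (fun a : EuclideanSpace ℝ (Fin d) × Regressors T K p q =>
      diffCov m a.1 A y a.2 i j) (θ₀, x₀) := by
  have hO : ∀ i j, ContDiffAt ℝ n (fun a : EuclideanSpace ℝ (Fin d) × Regressors T K p q =>
    m.Omega a.1 i j) (θ₀, x₀) := fun i j => (h.Omega i j).comp (θ₀, x₀) contDiffAt_fst
  have hS : ∀ i j, ContDiffAt ℝ n (fun a : EuclideanSpace ℝ (Fin d) × Regressors T K p q =>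
    m.Sigma a.1 i j) (θ₀, x₀) := fun i j => (h.Sigma i j).comp (θ₀, x₀) contDiffAt_fst
  have hx : ∀ (t : Fin T) (k l : Fin K) (r : Fin q),
      ContDiffAt ℝ n (fun a : EuclideanSpace ℝ (Fin d) × Regressors T K p q =>
        (a.2.2 t k - a.2.2 t l).ofLp r) (θ₀, x₀) := fun t k l r => by fun_prop
  simp only [diffCov, Matrix.of_apply]
  refine (contDiffAt_dotProduct (fun r => hx _ _ _ r)
    (contDiffAt_mulVec hO fun r => hx _ _ _ r)).add ?_
  split_ifs
  · exact (((hS _ _).sub (hS _ _)).sub (hS _ _)).add (hS _ _)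
  · exact contDiffAt_const

theorem RegularAt.eventually (h : RegularAt m n θ₀) :
    ∀ᶠ a : EuclideanSpace ℝ (Fin d) × Regressors T K p q in 𝓝 (θ₀, x₀),
      (m.Omega a.1).PosSemidef ∧ (m.Sigma a.1).PosDef :=
  (continuous_fst.tendsto (θ₀, x₀)).eventually (h.posSemidef.and h.posDef)

theorem RegularAt.diffCov_pos (h : RegularAt m n θ₀) (i : DiffIdx A y) : 0 < diffCov m θ₀ A y x₀ i i :=
  (posDef_diffCov A y x₀ m θ₀ h.posSemidef.self_of_nhds h.posDef.self_of_nhds).diag_pos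

theorem RegularAt.contDiffAt_sqrt_diffCov (h : RegularAt m n θ₀) (i : DiffIdx A y) :
    ContDiffAt ℝ n (fun a : EuclideanSpace ℝ (Fin d) × Regressors T K p q =>
      √(diffCov m a.1 A y a.2 i i)) (θ₀, x₀) :=
  (h.contDiffAt_diffCov x₀ A y i i).sqrt (h.diffCov_pos x₀ A y i).ne'

theorem RegularAt.contDiffAt_limits (h : RegularAt m n θ₀) (i : DiffIdx A y) :
    ContDiffAt ℝ n (fun a : EuclideanSpace ℝ (Fin d) × Regressors T K p q =>
      limits m a.1 A y a.2 i) (θ₀, x₀) :=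
  (h.contDiffAt_diffLimit x₀ A y i).div (h.contDiffAt_sqrt_diffCov x₀ A y i)
    (Real.sqrt_pos.2 (h.diffCov_pos x₀ A y i)).ne'

theorem RegularAt.contDiffAt_corr (h : RegularAt m n θ₀) (i j : DiffIdx A y) :
    ContDiffAt ℝ n (fun a : EuclideanSpace ℝ (Fin d) × Regressors T K p q =>
      corr m a.1 A y a.2 i j) (θ₀, x₀) :=
  (h.contDiffAt_diffCov x₀ A y i j).div
    ((h.contDiffAt_sqrt_diffCov x₀ A y i).mul (h.contDiffAt_sqrt_diffCov x₀ A y j))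
    (mul_pos (Real.sqrt_pos.2 (h.diffCov_pos x₀ A y i))
      (Real.sqrt_pos.2 (h.diffCov_pos x₀ A y j))).ne'

theorem RegularAt.contDiffAt_mnpProb (h : RegularAt m n θ₀) :
    ContDiffAt ℝ n (fun a : EuclideanSpace ℝ (Fin d) × Regressors T K p q =>
      mnpProb m a.1 A y a.2) (θ₀, x₀) := by
  have hev := h.eventually x₀
  refine (contDiffAt_multivariateGaussian_real (h.contDiffAt_diffCov x₀ A y)
    (h.contDiffAt_diffLimit x₀ A y) (hev.mono fun a ha => posDef_diffCov A y a.2 m a.1 ha.1 ha.2)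
    Set.univ).congr_of_eventuallyEq ?_
  exact hev.mono fun a ha => mnpProb_eq A y a.2 m a.1 ha.1 ha.2

theorem RegularAt.contDiffAt_sjProb (h : RegularAt m n θ₀) (o : Orderings T K) :
    ContDiffAt ℝ n (fun a : EuclideanSpace ℝ (Fin d) × Regressors T K p q =>
      sjProb m o a.1 A y a.2) (θ₀, x₀) := by
  refine (ContDiffAt.sum fun σ _ => ?_).div_const _
  refine contDiffAt_sjCDF (fun i j => h.contDiffAt_corr x₀ A y _ _)
    (fun i => h.contDiffAt_limits x₀ A y _) ((h.eventually x₀).mono fun a ha => ?_)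
  exact (posDef_corr A y a.2 m a.1 ha.1 ha.2).submatrix σ.injective

end JointSmoothness

/-! ### Compactness of the regressors and conclusion -/

theorem isCompact_bounded_regressors (M M' : ℝ) :
    IsCompact {x : Regressors T K p q | ∀ t k, ‖x.1 t k‖ ≤ M ∧ ‖x.2 t k‖ ≤ M'} := by
  have h := (isCompact_univ_pi fun _ : Fin T => isCompact_univ_pi fun _ : Fin K =>
    isCompact_closedBall (0 : EuclideanSpace ℝ (Fin p)) M).prod
    (isCompact_univ_pi fun _ : Fin T => isCompact_univ_pi fun _ : Fin K =>
      isCompact_closedBall (0 : EuclideanSpace ℝ (Fin q)) M')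
  convert h using 1
  ext x
  simp [Set.mem_prod, forall_and]

/-- The regularity conditions for the pairwise likelihood formed with pair probabilities which are
smooth and positive for regressors in a compact set. -/
theorem scoreConditions_lcml (P : Measure (Observation T K p q)) [IsProbabilityMeasure P]
    {π : EuclideanSpace ℝ (Fin d) → (A : Finset (Fin T)) → (A → Fin K) → Regressors T K p q → ℝ}
    {θ₀ : EuclideanSpace ℝ (Fin d)} {C : Set (Regressors T K p q)} (hC : IsCompact C)
    (hP : ∀ᵐ z ∂P, z.2 ∈ C)
    (hsmooth : ∀ x ∈ C, ∀ t t' : Fin T, t < t' → ∀ y : ({t, t'} : Finset (Fin T)) → Fin K,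
      ContDiffAt ℝ (3 : ℕ) (fun a : EuclideanSpace ℝ (Fin d) × Regressors T K p q =>
        π a.1 {t, t'} y a.2) (θ₀, x))
    (hpos : ∀ x ∈ C, ∀ t t' : Fin T, t < t' → ∀ y : ({t, t'} : Finset (Fin T)) → Fin K,
      0 < π θ₀ {t, t'} y x) :
    ScoreConditions P (lcml π) θ₀ := by
  refine scoreConditions_of_contDiffAt P (F := fun y a => ∑ t : Fin T, ∑ t' ∈ Finset.Ioi t,
    Real.log (π a.1 {t, t'} (choicesOn {t, t'} y) a.2)) hC hP fun y x hx => ?_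
  exact ContDiffAt.sum fun t _ => ContDiffAt.sum fun t' ht' =>
    (hsmooth x hx t t' (Finset.mem_Ioi.1 ht') _).log
      (hpos x hx t t' (Finset.mem_Ioi.1 ht') _).ne'

end PanelProbit

open scoped Matrix.Norms.L2Operator in
theorem theorem2 {T K p q d : ℕ} (m : PanelProbit.Param K p q d)
    (Θ : Set (EuclideanSpace ℝ (Fin d))) (hΘ : IsCompact Θ)
    -- the parametrisation
    (hbeta : ContDiffOn ℝ 3 m.beta (interior Θ))
    (hOmega : ∀ i j, ContDiffOn ℝ 3 (fun θ => m.Omega θ i j) (interior Θ))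
    (hSigma : ∀ i j, ContDiffOn ℝ 3 (fun θ => m.Sigma θ i j) (interior Θ))
    (hOmegaPSD : ∀ θ ∈ Θ, (m.Omega θ).PosSemidef)
    (hSigmaPD : ∀ θ ∈ Θ, (m.Sigma θ).PosDef)
    (MSigma : ℝ) (hSigmaInv : ∀ θ ∈ Θ, ‖(m.Sigma θ)⁻¹‖ ≤ MSigma)
    -- the true parameter
    (θ₀ : EuclideanSpace ℝ (Fin d)) (hθ₀ : θ₀ ∈ interior Θ)
    -- the law of the data, with bounded regressors
    (P : MeasureTheory.Measure (PanelProbit.Observation T K p q))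
    [MeasureTheory.IsProbabilityMeasure P] (MX MX' : ℝ)
    (hX : ∀ᵐ z ∂P, ∀ t k, ‖z.2.1 t k‖ ≤ MX ∧ ‖z.2.2 t k‖ ≤ MX') :
    (PanelProbit.GeneratedByMNP m θ₀ P →
      PanelProbit.ScoreConditions P (PanelProbit.lcml (PanelProbit.mnpProb m)) θ₀) ∧
    ∀ o : PanelProbit.Orderings T K, PanelProbit.GeneratedBySJ m o θ₀ P →
      -- the approximated probabilities of all pairs of choices are positive at `θ₀`
      (∀ x ∈ (P.map Prod.snd).support, ∀ t t' : Fin T, t < t' →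
        ∀ y : ({t, t'} : Finset (Fin T)) → Fin K,
          0 < PanelProbit.sjProb m o θ₀ {t, t'} y x) →
      PanelProbit.ScoreConditions P (PanelProbit.lcml (PanelProbit.sjProb m o)) θ₀ ∧
      PanelProbit.ScoreConditions P (PanelProbit.lcml (PanelProbit.sjProbNormalized m o)) θ₀ := by
  have hn : interior Θ ∈ 𝓝 θ₀ := isOpen_interior.mem_nhds hθ₀
  have hreg : PanelProbit.RegularAt m 3 θ₀ :=
    ⟨by exact_mod_cast hbeta.contDiffAt hn, fun i j => by exact_mod_cast (hOmega i j).contDiffAt hn,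
      fun i j => by exact_mod_cast (hSigma i j).contDiffAt hn,
      Filter.mem_of_superset hn fun θ hθ => hOmegaPSD θ (interior_subset hθ),
      Filter.mem_of_superset hn fun θ hθ => hSigmaPD θ (interior_subset hθ)⟩
  have hC := PanelProbit.isCompact_bounded_regressors (T := T) (K := K) (p := p) (q := q) MX MX'
  refine ⟨fun _ => PanelProbit.scoreConditions_lcml P hC hX
    (fun x _ t t' _ y => hreg.contDiffAt_mnpProb x {t, t'} y)
    (fun x _ t t' _ y => PanelProbit.mnpProb_pos {t, t'} y x m θ₀ hreg.posSemidef.self_of_nhds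
      hreg.posDef.self_of_nhds), fun o _ hpos => ?_⟩
  have hsupp : ∀ᵐ z ∂P, z.2 ∈ (P.map Prod.snd).support :=
    ae_of_ae_map measurable_snd.aemeasurable Measure.support_mem_ae
  -- Positivity is available only on the support; its closedness keeps the intersection compact.
  have hCs := hC.inter_right (Measure.isClosed_support (μ := P.map Prod.snd))
  have hXs := hX.and hsupp
  -- The extra pattern argument witnesses that the sum is not empty.
  have hsum : ∀ x ∈ (P.map Prod.snd).support, ∀ t t' : Fin T, t < t' →
      ∀ _ : ({t, t'} : Finset (Fin T)) → Fin K,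
      0 < ∑ y' : ({t, t'} : Finset (Fin T)) → Fin K, PanelProbit.sjProb m o θ₀ {t, t'} y' x :=
    fun x hx t t' ht y => Finset.sum_pos (fun y' _ => hpos x hx t t' ht y') ⟨y, Finset.mem_univ y⟩
  exact ⟨PanelProbit.scoreConditions_lcml P hCs hXs
      (fun x _ t t' _ y => hreg.contDiffAt_sjProb x {t, t'} y o)
      (fun x hx t t' ht y => hpos x hx.2 t t' ht y),
    PanelProbit.scoreConditions_lcml P hCs hXs
      (fun x hx t t' ht y => (hreg.contDiffAt_sjProb x {t, t'} y o).div
        (ContDiffAt.sum fun y' _ => hreg.contDiffAt_sjProb x {t, t'} y' o)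
        (hsum x hx.2 t t' ht y).ne')
      (fun x hx t t' ht y => div_pos (hpos x hx.2 t t' ht y) (hsum x hx.2 t t' ht y))⟩
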